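/- Use the standard notation of Nevanlinna theory: $T(r,f)$ is the Nevanlinna characteristic of a meromorphic function $f$ in $\mathbb{C}$, and $N(r,a,f)$, $\overline{N}(r,a,f)$ are the integrated counting functions of the $a$-points of $f$ ($a\in\mathbb{C}\cup\{\infty\}$), counted with and without multiplicity, respectively. Put $$\delta(a,f)=1-\limsup_{r\to\infty}\frac{N(r,a,f)}{T(r,f)},\qquad \Theta(a,f)=1-\limsup_{r\to\infty}\frac{\overline{N}(r,a,f)}{T(r,f)}.$$ A meromorphic function $\varphi$ is small with respect to $f$ if $T(r,\varphi)=o(T(r,f))$ as $r\to\infty$, possibly outside a set of $r$ of finite linear measure. Let $n\ge 2$ and $1\le p\le n$ be integers. Let $$P(z,f)=\sum_{j=1}^{\ell}a_j\,f^{n_{j0}}(f')^{n_{j1}}\cdots(f^{(k)})^{n_{jk}}$$ be a differential polynomial with non-negative integer exponents, of degree $\gamma_P=\max_{1\le j\le \ell}\sum_{s=0}^{k}n_{js}$ with $1\le\gamma_P\le n-1$. Let $f$ be a transcendental meromorphic function in $\mathbb{C}$, let the coefficients $a_j$ be meromorphic functions that are small with respect to $f$, and suppose that $f$ satisfies $$f^n+P(z,f)=h(z),$$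 where $h$ is a meromorphic function in $\mathbb{C}$ that satisfies a linear differential equation $$h^{(p)}+r_{p-1}(z)h^{(p-1)}+\cdots+r_1(z)h'+r_0(z)h=r_p(z)$$ with rational functions $r_0\not\equiv0,r_1,\dots,r_p$. (In particular, $p$ may be the least order of such an equation for $h$, but this is not required.) If $f$ is not of the form $qe^{\alpha}$ with a non-zero rational function $q$ and a non-constant polynomial $\alpha$, then $$\Theta(0,f)+\Theta(\infty,f)+\frac{n-\gamma_P}{p}\,\delta(\infty,f)\le 2.$$ -/

import Mathlib

/-! Meromorphic functions on `ℂ` are functions `f : ℂ → ℂ` with `Meromorphic f`.  Values at single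
points carry no meaning (in particular at poles), so identities between meromorphic functions are
stated as equalities outside a closed discrete subset of `ℂ`, that is, as `=ᶠ[Filter.codiscrete ℂ]`.
Derivatives `iteratedDeriv k f` are the right ones wherever `f` is analytic, hence off such a set. -/

namespace TumuraClunie

open Filter Topology ValueDistribution

/-- The Nevanlinna characteristic `T(r, f) = m(r, f) + N(r, ∞, f)`. -/
noncomputable def T (f : ℂ → ℂ) : ℝ → ℝ := characteristic f ⊤

/-- The support of a divisor, every point being counted with multiplicity one. -/
noncomputable def reduced (D : Function.locallyFinsupp ℂ ℤ) : Function.locallyFinsupp ℂ ℤ where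
  toFun z := if D z = 0 then 0 else 1
  supportWithinDomain' := Set.subset_univ _
  supportLocallyFiniteWithinDomain' z hz := by
    obtain ⟨t, ht, hfin⟩ := D.supportLocallyFiniteWithinDomain' z hz
    refine ⟨t, ht, hfin.subset ?_⟩
    rintro w ⟨hw, hw'⟩
    refine ⟨hw, ?_⟩
    simp only [Function.mem_support, ne_eq] at hw' ⊢
    intro h0
    exact hw' (if_pos h0)

open Classical in
/-- The reduced integrated counting function `N̄(r, a, f)`, `a ∈ ℂ ∪ {∞}`: like
`ValueDistribution.logCounting`, but every `a`-point is counted without multiplicity. -/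
noncomputable def reducedLogCounting (f : ℂ → ℂ) (a : WithTop ℂ) : ℝ → ℝ :=
  if a = ⊤ then
    (reduced (MeromorphicOn.divisor f Set.univ)⁻).logCounting
  else
    (reduced (MeromorphicOn.divisor (fun z ↦ f z - a.untop₀) Set.univ)⁺).logCounting

/-- The deficiency `δ(a, f) = 1 - limsup N(r, a, f) / T(r, f)`.  (For non-constant meromorphic `f`
the quotient is bounded as `r → ∞`, so that the real-valued `limsup` is the usual one.) -/
noncomputable def deficiency (a : WithTop ℂ) (f : ℂ → ℂ) : ℝ :=
  1 - limsup (fun r : ℝ ↦ logCounting f a r / T f r) atTop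

/-- The quantity `Θ(a, f) = 1 - limsup N̄(r, a, f) / T(r, f)`. -/
noncomputable def ramifiedDeficiency (a : WithTop ℂ) (f : ℂ → ℂ) : ℝ :=
  1 - limsup (fun r : ℝ ↦ reducedLogCounting f a r / T f r) atTop

/-- `u(r) = S(r, f)`: `u(r) = o(T(r, f))` as `r → ∞`, outside a set of finite linear measure. -/
def IsSmallQuantity (u : ℝ → ℝ) (f : ℂ → ℂ) : Prop :=
  ∃ E : Set ℝ, MeasureTheory.volume E < ⊤ ∧ u =o[atTop ⊓ 𝓟 Eᶜ] T f

/-- The meromorphic function `φ` is small with respect to `f`: `T(r, φ) = S(r, f)`. -/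
def IsSmall (φ f : ℂ → ℂ) : Prop := IsSmallQuantity (T φ) f

/-- The function on `ℂ` given by a rational function. -/
noncomputable def ratEval (q : RatFunc ℂ) (z : ℂ) : ℂ := q.eval (RingHom.id ℂ) z

/-- `f` is a transcendental meromorphic function: meromorphic in `ℂ` and not rational. -/
def TranscendentalMeromorphic (f : ℂ → ℂ) : Prop :=
  Meromorphic f ∧ ¬ ∃ q : RatFunc ℂ, f =ᶠ[codiscrete ℂ] ratEval q

/-- A differential polynomial
`P(z, f) = ∑_{j} a_j f^{n_{j0}} (f')^{n_{j1}} ⋯ (f^{(k)})^{n_{jk}}` with `ℓ` terms and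
meromorphic coefficients `a_j`. -/
structure DiffPoly where
  /-- the number of terms -/
  ℓ : ℕ
  /-- the highest order of a derivative -/
  k : ℕ
  /-- the coefficients `a_j` -/
  coeff : Fin ℓ → ℂ → ℂ
  /-- the exponents `n_{js}` -/
  exponent : Fin ℓ → Fin (k + 1) → ℕ
  meromorphic_coeff : ∀ j, Meromorphic (coeff j)

/-- The function `z ↦ P(z, f)`. -/
noncomputable def DiffPoly.apply (P : DiffPoly) (f : ℂ → ℂ) (z : ℂ) : ℂ :=
  ∑ j, P.coeff j z * ∏ s : Fin (P.k + 1), iteratedDeriv s f z ^ P.exponent j s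

/-- The degree `γ_P = max_j ∑_s n_{js}`. -/
def DiffPoly.degree (P : DiffPoly) : ℕ :=
  Finset.univ.sup fun j ↦ ∑ s, P.exponent j s

/-- `f` is a solution of `f ^ n + P(z, f) = h(z)`. -/
def SolvesTumuraClunie (n : ℕ) (P : DiffPoly) (h f : ℂ → ℂ) : Prop :=
  (fun z ↦ f z ^ n + P.apply f z) =ᶠ[codiscrete ℂ] h

/-- `h` is a solution of `h^{(p)} + r_{p-1} h^{(p-1)} + ⋯ + r_1 h' + r_0 h = r_p`, with rational
functions `r_0, …, r_p` (the entries of the sequence `r` beyond `p` are not used). -/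
def SolvesLinearODE (p : ℕ) (r : ℕ → RatFunc ℂ) (h : ℂ → ℂ) : Prop :=
  (fun z ↦ iteratedDeriv p h z + ∑ s ∈ Finset.range p, ratEval (r s) z * iteratedDeriv s h z)
    =ᶠ[codiscrete ℂ] ratEval (r p)

/-- `f = q e^α` with a non-zero rational function `q` and a non-constant polynomial `α`. -/
def IsRationalMulExp (f : ℂ → ℂ) : Prop :=
  ∃ (q : RatFunc ℂ) (α : Polynomial ℂ), q ≠ 0 ∧ 0 < α.natDegree ∧
    f =ᶠ[codiscrete ℂ] fun z ↦ ratEval q z * Complex.exp (α.eval z)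

end TumuraClunie

/-! Write `L` for the operator `g ↦ g^{(p)} + ∑_{s<p} r_s g^{(s)}`, and `γ` for the degree of `P`.
Applying `L` to `f^n + P(z, f) = h` removes `h` and leaves `L(f^n) + L(P(z, f)) = r_p`. With `φ =
L(f^n) / f^n` this reads `f^n φ = r_p - ∑ f^{d_j} c_j`, where `d_j ≤ γ`. The `c_j` are products of
small coefficients and of quotients of the type `g^{(s)} / g`, so the lemma on the logarithmic
derivative gives them proximity functions `S(r, f)`. Clunie's argument (`norm_pow_mul_le`) then
yields `m(r, f^{n-γ} φ) = S(r, f)`.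

If `φ` is not identically zero, then `(n - γ) m(r, f) ≤ m(r, 1/φ) + S(r, f) ≤ N(r, φ) + S(r, f)` by
the first main theorem and `m(r, φ) = S(r, f)`. A zero or pole of `f`, whatever its multiplicity,
gives `φ` a pole of order at most `p`, and other poles come only from the rational coefficients.
Hence `(n - γ) m(r, f) ≤ p (N̄(r, 0, f) + N̄(r, ∞, f)) + S(r, f)` (`proximity_estimate`), and
division by `T(r, f)` gives the deficiency relation (`deficiency_sum_le`).

If `φ` vanishes identically, `f^n` solves a homogeneous linear equation. Since `p ≤ n`, comparing
orders shows that `f` has finitely many zeros and poles, so `f = q e^G` with `q` rational and `G`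
entire. If `G'` were transcendental, the equation, read as a polynomial equation for the logarithmic
derivative of `f^n`, would force `m(r, G') = S(r, G')`, absurd for an entire function. So `G'` is a
polynomial and `f` has the excluded form (`isRationalMulExp_of_linOp_pow_eq_zero`).

Two classical facts are proved on the way: the lemma on the logarithmic derivative
(`exists_proximity_logDeriv_le`), and `log r = o(T(r, f))` for transcendental `f`. -/

namespace TumuraClunie

open Filter Topology ValueDistribution MeasureTheory Metric Real
open scoped ComplexConjugate

/-! ### Exceptional sets of finite measure and Borel's growth lemma -/

/-- The filter of neighbourhoods of `+∞`, up to exceptional sets of finite Lebesgue measure. -/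
noncomputable abbrev exceptional : Filter ℝ := atTop ⊓ (volume : Measure ℝ).cofinite

instance exceptional_neBot : NeBot exceptional := by
  rw [inf_neBot_iff]
  intro s hs t ht
  obtain ⟨a, ha⟩ := mem_atTop_sets.1 hs
  by_contra hne
  have hsub : Set.Ici a ⊆ tᶜ := fun x hx hxt ↦ hne ⟨x, ha x hx, hxt⟩
  have := (measure_mono hsub).trans_lt (Measure.mem_cofinite.1 ht)
  simp at this

/-- Each smallness hypothesis comes with its own exceptional set. Passing to one common filter lets
finitely many of them be intersected without naming the sets. -/
lemma exceptional_le_of_volume_lt_top {E : Set ℝ} (hE : volume E < ⊤) :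
    exceptional ≤ atTop ⊓ 𝓟 Eᶜ :=
  inf_le_inf_left _ (le_principal_iff.2 (Measure.compl_mem_cofinite.2 hE))

/-- **Borel's growth lemma**: outside a set of finite measure, a nondecreasing function `τ ≥ 1`
satisfies `τ (r + 1 / τ r) ≤ 2 τ r`. -/
theorem eventually_apply_add_inv_le {τ : ℝ → ℝ} {a : ℝ} (hm : MonotoneOn τ (Set.Ici a))
    (h1 : ∀ r, a ≤ r → 1 ≤ τ r) : ∀ᶠ r in exceptional, τ (r + (τ r)⁻¹) ≤ 2 * τ r := by
  set S : Set ℝ := {r | a ≤ r ∧ 2 * τ r < τ (r + (τ r)⁻¹)} with hS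
  -- The bad set is cut into levels `2^k ≤ τ < 2^(k+1)`. From a bad point, a step of length `(τ r)⁻¹
  -- ≤ 2^(-k)` doubles `τ` and so leaves the level; hence each level has diameter at most `2^(-k)`,
  -- and these are summable.
  let E : ℕ → Set ℝ := fun k ↦ {r | r ∈ S ∧ (2 : ℝ) ^ k ≤ τ r ∧ τ r < 2 ^ (k + 1)}
  have hsub : S ⊆ ⋃ k, E k := by
    intro r hr
    obtain ⟨k, hk⟩ := exists_nat_pow_near (h1 r hr.1) (one_lt_two)
    exact Set.mem_iUnion.2 ⟨k, hr, hk⟩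
  have key : ∀ k, ∀ r ∈ E k, ∀ s ∈ E k, r ≤ s → s - r ≤ (1 / 2) ^ k := by
    intro k r hr s hs hrs
    by_contra! hlt
    have hτ : (τ r)⁻¹ ≤ (1 / 2) ^ k := by
      rw [one_div, inv_pow]
      exact inv_anti₀ (by positivity) hr.2.1
    have hpos : 0 < (τ r)⁻¹ := inv_pos.2 (by linarith [h1 r hr.1.1])
    have h2 : τ (r + (τ r)⁻¹) ≤ τ s :=
      hm (by simp only [Set.mem_Ici]; linarith [hr.1.1]) hs.1.1 (by linarith)
    have h3 := hr.1.2
    have h4 := hs.2.2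
    have h5 := hr.2.1
    rw [pow_succ] at h4
    linarith
  have hvol : ∀ k, volume (E k) ≤ (2⁻¹ : ENNReal) ^ k := by
    intro k
    refine (Real.volume_le_diam _).trans (Metric.ediam_le fun r hr s hs ↦ ?_)
    have : dist r s ≤ (1 / 2) ^ k := by
      rcases le_total r s with h | h
      · rw [dist_comm, Real.dist_eq, abs_of_nonneg (by linarith)]; exact key k r hr s hs h
      · rw [Real.dist_eq, abs_of_nonneg (by linarith)]; exact key k s hs r hr h
    rw [edist_dist]
    refine (ENNReal.ofReal_le_ofReal this).trans_eq ?_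
    rw [ENNReal.ofReal_pow (by norm_num), one_div, ENNReal.ofReal_inv_of_pos (by norm_num)]
    simp
  have hfin : volume S < ⊤ := by
    refine ((measure_mono hsub).trans (measure_iUnion_le _)).trans_lt ?_
    refine (ENNReal.tsum_le_tsum hvol).trans_lt ?_
    rw [ENNReal.tsum_geometric]
    simp
  filter_upwards [mem_inf_of_left (Ici_mem_atTop a),
    mem_inf_of_right (Measure.compl_mem_cofinite.2 hfin)] with r hr hrS
  by_contra! hlt
  exact hrS ⟨hr, hlt⟩

/-! ### An estimate of the derivative from the real part on a circle -/

lemma norm_circleAverage_le {f : ℂ → ℂ} {F : ℂ → ℝ} {c : ℂ} {R : ℝ} (hF : CircleIntegrable F c R)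
    (h : ∀ z ∈ sphere c |R|, ‖f z‖ ≤ F z) : ‖circleAverage f c R‖ ≤ circleAverage F c R := by
  rw [circleAverage_def, circleAverage_def, norm_smul, smul_eq_mul, Real.norm_eq_abs,
    abs_of_pos (inv_pos.2 two_pi_pos)]
  refine mul_le_mul_of_nonneg_left ?_ (inv_pos.2 two_pi_pos).le
  refine intervalIntegral.norm_integral_le_of_norm_le two_pi_pos.le ?_ hF
  exact Eventually.of_forall fun θ _ ↦ h _ (circleMap_mem_sphere' c R θ)

/-- The derivative of the Schwarz integral formula, as an estimate. -/
theorem norm_deriv_le_circleAverage_abs_re {G : ℂ → ℂ} {R ρ : ℝ} {z : ℂ}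
    (hG : DifferentiableOn ℂ G (ball 0 ρ)) (hRρ : R < ρ) (hz : ‖z‖ < R) :
    ‖deriv G z‖ ≤ 2 * R / (R - ‖z‖) ^ 2 * circleAverage (fun w ↦ |(G w).re|) 0 R := by
  have hR : 0 < R := (norm_nonneg z).trans_lt hz
  have hsub : closedBall (0 : ℂ) R ⊆ ball 0 ρ := closedBall_subset_ball hRρ
  have hGc : ContinuousOn G (sphere 0 |R|) := by
    rw [abs_of_pos hR]
    exact hG.continuousOn.mono (sphere_subset_closedBall.trans hsub)
  have hne : ∀ w ∈ sphere (0 : ℂ) |R|, w - z ≠ 0 := by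
    intro w hw h
    rw [sub_eq_zero] at h
    subst h
    rw [mem_sphere_zero_iff_norm, abs_of_pos hR] at hw
    exact hz.ne hw
  set k : ℂ → ℂ := fun w ↦ w * ((w - z) ^ 2)⁻¹ with hk
  have hkc : ContinuousOn k (sphere 0 |R|) := by
    refine continuousOn_id.mul (ContinuousOn.inv₀ (by fun_prop) fun w hw ↦ pow_ne_zero 2 (hne w hw))
  have hconjc : ContinuousOn (fun w ↦ conj (G w)) (sphere 0 |R|) :=
    Complex.continuous_conj.comp_continuousOn hGc
  have h1 : circleAverage (fun w ↦ k w * G w) 0 R = deriv G z := by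
    rw [circleAverage_eq_circleIntegral hR.ne',
      ← Complex.two_pi_I_inv_smul_circleIntegral_sub_sq_inv_smul_of_differentiable isOpen_ball hsub hG
        (by simpa using hz : z ∈ ball (0 : ℂ) R)]
    congr 1
    refine circleIntegral.integral_congr hR.le fun w hw ↦ ?_
    have : w ≠ 0 := by
      rintro rfl
      simp at hw
      exact hR.ne hw
    simp only [hk, smul_eq_mul, sub_zero]
    field_simp
  have hden : ∀ w : ℂ, ‖w‖ ≤ R → (R : ℂ) ^ 2 - w * conj z ≠ 0 := by
    intro w hw h
    rw [sub_eq_zero] at h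
    have := congrArg norm h
    simp only [norm_pow, Complex.norm_real, Real.norm_eq_abs, abs_of_pos hR, norm_mul,
      RCLike.norm_conj] at this
    nlinarith [norm_nonneg z, norm_nonneg w]
  -- On the circle `conj w = R² / w`, so the conjugate of `k · conj G` has the boundary values of a
  -- holomorphic `H` with `H 0 = 0`, and its mean vanishes. Adding this mean to Cauchy's formula
  -- replaces `G` by `2 Re G`.
  have h2 : circleAverage (fun w ↦ k w * conj (G w)) 0 R = 0 := by
    set H : ℂ → ℂ := fun w ↦ (R : ℂ) ^ 2 * w * (((R : ℂ) ^ 2 - w * conj z) ^ 2)⁻¹ * G w with hH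
    have hHd : DiffContOnCl ℂ H (ball 0 |R|) := by
      rw [abs_of_pos hR]
      refine DifferentiableOn.diffContOnCl ?_
      rw [closure_ball _ hR.ne']
      refine DifferentiableOn.mul (DifferentiableOn.mul (by fun_prop) ?_) (hG.mono hsub)
      refine DifferentiableOn.inv (by fun_prop) fun w hw ↦ pow_ne_zero 2 (hden w (by simpa using hw))
    have hH0 : circleAverage H 0 R = 0 := by
      rw [hHd.circleAverage]; simp [hH]
    have hHc : CircleIntegrable H 0 R := by
      refine ContinuousOn.circleIntegrable' (hHd.continuousOn.mono ?_)
      rw [abs_of_pos hR, closure_ball _ hR.ne']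
      exact sphere_subset_closedBall
    have hcomm := (Complex.conjCLE.toContinuousLinearMap).circleAverage_comp_comm hHc
    rw [hH0, map_zero] at hcomm
    refine Eq.trans ?_ hcomm
    refine circleAverage_congr_sphere fun w hw ↦ ?_
    have hw' : ‖w‖ = R := by simpa [abs_of_pos hR] using hw
    have hwne := hne w hw
    have hw0 : w ≠ 0 := by rintro rfl; simp at hw'; exact hR.ne hw'
    have hww : (R : ℂ) ^ 2 = w * conj w := by
      rw [Complex.mul_conj, Complex.normSq_eq_norm_sq, hw']; push_cast; rfl
    have hcz : conj w - conj z ≠ 0 := by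
      rw [← map_sub]; exact (map_ne_zero _).2 hwne
    simp only [hk, hH, Function.comp_apply, ContinuousLinearEquiv.coe_coe, Complex.conjCLE_apply,
      hww, map_mul, map_inv₀, map_pow, map_sub, Complex.conj_conj]
    have hcw : conj w ≠ 0 := by simpa using hw0
    have : conj w * w - conj w * z = conj w * (w - z) := by ring
    rw [this]
    field_simp
  have h3 : deriv G z = circleAverage (fun w ↦ k w * (2 * (G w).re)) 0 R := by
    rw [← h1, ← add_zero (circleAverage (fun w ↦ k w * G w) 0 R)]
    nth_rw 2 [← h2]
    rw [← circleAverage_fun_add]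
    · refine circleAverage_congr_sphere fun w _ ↦ ?_
      rw [← mul_add, Complex.add_conj]
      push_cast
      rfl
    · exact (hkc.mul hGc).circleIntegrable'
    · exact (hkc.mul hconjc).circleIntegrable'
  have hrec : ContinuousOn (fun w ↦ |(G w).re|) (sphere 0 |R|) :=
    continuous_abs.comp_continuousOn (Complex.continuous_re.comp_continuousOn hGc)
  rw [h3, ← smul_eq_mul (a := 2 * R / _), ← circleAverage_fun_smul]
  refine norm_circleAverage_le (ContinuousOn.circleIntegrable' (by fun_prop)) fun w hw ↦ ?_
  have hw' : ‖w‖ = R := by simpa [abs_of_pos hR] using hw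
  have hd : R - ‖z‖ ≤ ‖w - z‖ := by
    rw [← hw']; exact norm_sub_norm_le w z
  have hd0 : 0 < R - ‖z‖ := by linarith
  simp only [hk, norm_mul, norm_inv, norm_pow, hw', Complex.norm_real, Real.norm_eq_abs,
    Complex.norm_ofNat, smul_eq_mul]
  have : (‖w - z‖ ^ 2)⁻¹ ≤ ((R - ‖z‖) ^ 2)⁻¹ := by gcongr
  calc R * (‖w - z‖ ^ 2)⁻¹ * (2 * |(G w).re|) ≤ R * ((R - ‖z‖) ^ 2)⁻¹ * (2 * |(G w).re|) := by gcongr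
    _ = _ := by ring

/-! ### Counting points in disks, and circle means with weak singularities -/

/-- Bounding the number of points of an effective divisor in a disk by its integrated counting
function on a bigger disk. -/
lemma sum_mul_log_le_logCounting {D : Function.locallyFinsupp ℂ ℤ} (hD : 0 ≤ D) {r R : ℝ}
    (hr : 1 ≤ r) (hrR : r < R) (s : Finset ℂ) (hs : ∀ a ∈ s, ‖a‖ ≤ r) :
    (∑ a ∈ s, (D a : ℝ)) * log (R / r) ≤ Function.locallyFinsuppWithin.logCounting D R := by
  classical
  have hR : 0 < R := by linarith
  have hr0 : 0 < r := by linarith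
  have hfin : (Function.locallyFinsuppWithin.toClosedBall R D).support.Finite :=
    Function.locallyFinsuppWithin.finiteSupport _ (isCompact_closedBall 0 |R|)
  set t : Finset ℂ := insert 0 (s ∪ hfin.toFinset) with ht
  have hball : ∀ z : ℂ, ‖z‖ ≤ R → Function.locallyFinsuppWithin.toClosedBall R D z = D z := by
    intro z hz
    apply Function.locallyFinsuppWithin.toClosedBall_eval_within
    simpa [abs_of_pos hR] using hz
  have hDn : ∀ z, (0 : ℝ) ≤ D z := fun z ↦ by exact_mod_cast hD z
  have htn : ∀ z, (0 : ℝ) ≤ Function.locallyFinsuppWithin.toClosedBall R D z := by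
    intro z
    by_cases hz : ‖z‖ ≤ R
    · rw [hball z hz]; exact hDn z
    · rw [Function.locallyFinsuppWithin.apply_eq_zero_of_notMem _ (by simpa [abs_of_pos hR] using hz)]
      simp
  have hcount : Function.locallyFinsuppWithin.logCounting D R
      = ∑ z ∈ t, ((Function.locallyFinsuppWithin.toClosedBall R D z : ℝ) * log (R * ‖z‖⁻¹)
        + if z = 0 then D 0 * log R else 0) := by
    rw [Finset.sum_add_distrib, Finset.sum_ite_eq' t (0 : ℂ)]
    simp only [Function.locallyFinsuppWithin.logCounting, AddMonoidHom.coe_mk, ZeroHom.coe_mk]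
    rw [if_pos (Finset.mem_insert_self _ _), finsum_eq_sum_of_support_subset]
    intro z hz
    have : Function.locallyFinsuppWithin.toClosedBall R D z ≠ 0 := by
      intro h; simp [h] at hz
    simp [ht, this]
  have hlogR : 0 ≤ log R := log_nonneg (by linarith)
  have hterm0 : ∀ z, 0 ≤ (Function.locallyFinsuppWithin.toClosedBall R D z : ℝ) * log (R * ‖z‖⁻¹)
        + if z = 0 then D 0 * log R else 0 := by
    intro z
    refine add_nonneg ?_ ?_
    · by_cases hz : ‖z‖ ≤ R
      · refine mul_nonneg (htn z) ?_
        rcases eq_or_ne z 0 with rfl | h0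
        · simp
        · refine log_nonneg ?_
          rw [← div_eq_mul_inv, le_div_iff₀ (norm_pos_iff.2 h0)]
          linarith
      · rw [Function.locallyFinsuppWithin.apply_eq_zero_of_notMem _ (by simpa [abs_of_pos hR] using hz)]
        simp
    · split_ifs
      · exact mul_nonneg (hDn 0) hlogR
      · exact le_rfl
  rw [hcount, Finset.sum_mul]
  refine (Finset.sum_le_sum fun z hz ↦ ?_).trans
    (Finset.sum_le_sum_of_subset_of_nonneg (fun z hz ↦ by simp [ht, hz]) fun z _ _ ↦ hterm0 z)
  have hz' := hs z hz
  rw [hball z (by linarith)]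
  rcases eq_or_ne z 0 with rfl | h0
  -- At the origin `log (R * ‖0‖⁻¹)` is `0` by convention; the separate term `D 0 * log R` does the
  -- work, and it suffices because `r ≥ 1`.
  · simp only [norm_zero, inv_zero, mul_zero, log_zero, if_true, zero_add]
    refine mul_le_mul_of_nonneg_left (log_le_log (by positivity) ?_) (hDn 0)
    exact div_le_self hR.le hr
  · rw [if_neg h0, add_zero, div_eq_mul_inv]
    have := norm_pos_iff.2 h0
    refine mul_le_mul_of_nonneg_left (log_le_log (by positivity) ?_) (hDn z)
    gcongr

/-- Over one period centred at `0`, Jordan's inequality `|sin θ| ≥ 2 |θ| / π` compares the function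
with `|θ|^(-1/2)`. -/
lemma intervalIntegrable_inv_sqrt_abs_sin (a b : ℝ) :
    IntervalIntegrable (fun θ ↦ (√|sin θ|)⁻¹) volume a b := by
  have hper : Function.Periodic (fun θ ↦ (√|sin θ|)⁻¹) π := by
    intro θ; simp [sin_add_pi]
  have hbase : IntervalIntegrable (fun θ : ℝ ↦ √(π / 2) * (√|θ|)⁻¹) volume (-(π / 2)) (π / 2) := by
    refine IntervalIntegrable.const_mul ?_ _
    refine intervalIntegrable_of_even (by simp) fun x hx ↦ ?_
    have := (intervalIntegral.intervalIntegrable_rpow' (a := 0) (b := x) (r := -(1 / 2)) (by norm_num))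
    rw [intervalIntegrable_iff, Set.uIoc_of_le hx.le] at this ⊢
    refine this.congr_fun (fun y hy ↦ ?_) measurableSet_Ioc
    simp only
    rw [rpow_neg hy.1.le, ← sqrt_eq_rpow, abs_of_pos hy.1]
  refine hper.intervalIntegrable pi_ne_zero (t := -(π / 2)) ?_ a b
  have hend : -(π / 2) + π = π / 2 := by ring
  rw [hend]
  refine hbase.mono_fun' ?_ ?_
  · exact (by fun_prop : Measurable fun θ ↦ (√|sin θ|)⁻¹).aestronglyMeasurable
  · refine (ae_restrict_iff' measurableSet_uIoc).2 (Eventually.of_forall fun θ hθ ↦ ?_)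
    rw [Set.uIoc_of_le (by linarith [pi_pos])] at hθ
    have hle : 2 / π * |θ| ≤ |sin θ| := mul_abs_le_abs_sin (abs_le.2 ⟨hθ.1.le, hθ.2⟩)
    simp only [norm_inv, Real.norm_eq_abs, abs_of_nonneg (sqrt_nonneg _)]
    rcases eq_or_ne θ 0 with rfl | h0
    · simp
    have hpos : 0 < 2 / π * |θ| := by have := abs_pos.2 h0; positivity
    calc (√|sin θ|)⁻¹ ≤ (√(2 / π * |θ|))⁻¹ := by
          exact inv_anti₀ (sqrt_pos.2 hpos) (sqrt_le_sqrt hle)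
      _ = √(π / 2) * (√|θ|)⁻¹ := by
          rw [sqrt_mul (by positivity), mul_inv, ← sqrt_inv, inv_div]

/-- The averages of `‖z - a‖ ^ (-1/2)` over circles of radius `≥ 1` are uniformly bounded. -/
lemma exists_circleAverage_inv_sqrt_norm_sub_le : ∃ c : ℝ, 0 ≤ c ∧ ∀ (a : ℂ) (r : ℝ), 1 ≤ r →
    CircleIntegrable (fun z ↦ (√‖z - a‖)⁻¹) 0 r ∧
      circleAverage (fun z ↦ (√‖z - a‖)⁻¹) 0 r ≤ c := by
  refine ⟨(2 * π)⁻¹ * ∫ θ in (0)..(2 * π), (√|sin θ|)⁻¹, ?_, fun a r hr ↦ ?_⟩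
  · refine mul_nonneg (by positivity) (intervalIntegral.integral_nonneg two_pi_pos.le fun θ _ ↦ ?_)
    positivity
  set φ := Complex.arg a
  have hper : Function.Periodic (fun θ ↦ (√|sin θ|)⁻¹) (2 * π) := by
    intro θ; simp [sin_add_two_pi]
  have hint : IntervalIntegrable (fun θ ↦ (√|sin (θ - φ)|)⁻¹) volume 0 (2 * π) := by
    have := (intervalIntegrable_inv_sqrt_abs_sin (0 - φ) (2 * π - φ)).comp_sub_right φ
    simpa using this
  have hval : ∫ θ in (0)..(2 * π), (√|sin (θ - φ)|)⁻¹ = ∫ θ in (0)..(2 * π), (√|sin θ|)⁻¹ := by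
    rw [intervalIntegral.integral_comp_sub_right (fun θ ↦ (√|sin θ|)⁻¹) φ]
    have := hper.intervalIntegral_add_eq (0 - φ) 0
    rw [zero_add] at this
    rw [← this]
    congr 1
    ring
  -- Rotating `a` onto the non-negative real axis, the imaginary part of the rotated `z - a` is `r
  -- sin (θ - φ)`. It does not involve `‖a‖`, which is why the bound is uniform in `a`.
  have hnorm : ∀ θ : ℝ, |sin (θ - φ)| ≤ ‖circleMap 0 r θ - a‖ := by
    intro θ
    have h1 : ((circleMap 0 r θ - a) * Complex.exp (-(φ : ℂ) * Complex.I)).im = r * sin (θ - φ) := by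
      have ha : a * Complex.exp (-(φ : ℂ) * Complex.I) = (‖a‖ : ℂ) := by
        conv_lhs => rw [← Complex.norm_mul_exp_arg_mul_I a]
        rw [mul_assoc, ← Complex.exp_add]
        simp [φ]
      rw [sub_mul, ha, circleMap_zero, mul_assoc, ← Complex.exp_add, ← add_mul,
        Complex.sub_im, Complex.ofReal_im, sub_zero, Complex.im_ofReal_mul, ← Complex.ofReal_neg,
        ← Complex.ofReal_add, Complex.exp_ofReal_mul_I_im, sub_eq_add_neg]
    have h2 := Complex.abs_im_le_norm ((circleMap 0 r θ - a) * Complex.exp (-(φ : ℂ) * Complex.I))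
    rw [h1, norm_mul, ← Complex.ofReal_neg, Complex.norm_exp_ofReal_mul_I, mul_one, abs_mul,
      abs_of_pos (by linarith : (0 : ℝ) < r)] at h2
    exact (le_mul_of_one_le_left (abs_nonneg _) hr).trans h2
  have hae : ∀ᵐ θ : ℝ, (√‖circleMap 0 r θ - a‖)⁻¹ ≤ (√|sin (θ - φ)|)⁻¹ := by
    have hnull : volume (Set.range fun m : ℤ ↦ (m : ℝ) * π + φ) = 0 :=
      (Set.countable_range _).measure_zero _
    filter_upwards [compl_mem_ae_iff.2 hnull] with θ hθ
    have hne : sin (θ - φ) ≠ 0 := by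
      intro h
      obtain ⟨m, hm⟩ := Real.sin_eq_zero_iff.1 h
      exact hθ ⟨m, by simp only; linarith⟩
    exact inv_anti₀ (sqrt_pos.2 (abs_pos.2 hne)) (sqrt_le_sqrt (hnorm θ))
  have hci : CircleIntegrable (fun z ↦ (√‖z - a‖)⁻¹) 0 r := by
    refine hint.mono_fun' ?_ ?_
    · exact (by fun_prop : Measurable fun θ ↦ (√‖circleMap 0 r θ - a‖)⁻¹).aestronglyMeasurable
    · filter_upwards [ae_restrict_of_ae hae] with θ hθ
      rwa [Real.norm_of_nonneg (by positivity)]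
  refine ⟨hci, ?_⟩
  rw [circleAverage_def, smul_eq_mul, ← hval]
  refine mul_le_mul_of_nonneg_left ?_ (by positivity)
  exact intervalIntegral.integral_mono_ae two_pi_pos.le hci hint hae

/-! ### Logarithms of zero-free functions and means of the absolute value of `log ‖·‖` -/

/-- For a primitive `G` of `e' / e`, normalised by the value of `log e` at `0`, the function `e ·
exp (-G)` has derivative zero and is `1` at `0`. -/
lemma exists_eq_exp_of_isExactOn {e : ℂ → ℂ} {U : Set ℂ} (hU : IsOpen U) (hU' : IsPreconnected U)
    (h0 : (0 : ℂ) ∈ U) (he : DifferentiableOn ℂ e U) (hne : ∀ z ∈ U, e z ≠ 0)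
    (hex : Complex.IsExactOn (fun z ↦ deriv e z / e z) U) :
    ∃ G : ℂ → ℂ, DifferentiableOn ℂ G U ∧ ∀ z ∈ U, e z = Complex.exp (G z) := by
  obtain ⟨G, hG0, hG⟩ := hex.with_val_at 0 (Complex.log (e 0))
  have hd : ∀ z ∈ U, HasDerivAt (fun w ↦ e w * Complex.exp (-G w)) 0 z := by
    intro z hz
    have h1 := ((he.differentiableAt (hU.mem_nhds hz)).hasDerivAt).mul (hG z hz).neg.cexp
    refine h1.congr_deriv ?_
    have h2 : e z * (deriv e z / e z) = deriv e z := mul_div_cancel₀ _ (hne z hz)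
    linear_combination -Complex.exp (-G z) * h2
  obtain ⟨a, ha⟩ := hU.exists_is_const_of_deriv_eq_zero hU'
    (fun z hz ↦ (hd z hz).differentiableAt.differentiableWithinAt) (fun z hz ↦ (hd z hz).deriv)
  have ha1 : a = 1 := by
    rw [← ha 0 h0, hG0, Complex.exp_neg, Complex.exp_log (hne 0 h0), mul_inv_cancel₀ (hne 0 h0)]
  refine ⟨G, fun z hz ↦ (hG z hz).differentiableAt.differentiableWithinAt, fun z hz ↦ ?_⟩
  have := ha z hz
  rw [ha1, Complex.exp_neg, ← div_eq_mul_inv, div_eq_one_iff_eq (Complex.exp_ne_zero _)] at this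
  exact this

lemma exists_eq_exp_on_ball {e : ℂ → ℂ} {R : ℝ} (hR : 0 < R)
    (he : DifferentiableOn ℂ e (ball 0 R)) (hne : ∀ z ∈ ball (0 : ℂ) R, e z ≠ 0) :
    ∃ G : ℂ → ℂ, DifferentiableOn ℂ G (ball 0 R) ∧ ∀ z ∈ ball (0 : ℂ) R, e z = Complex.exp (G z) :=
  exists_eq_exp_of_isExactOn isOpen_ball (convex_ball _ _).isPreconnected (mem_ball_self hR) he hne
    ((he.deriv isOpen_ball).div he hne).isExactOn_ball

lemma exists_eq_exp_of_differentiable {e : ℂ → ℂ} (he : Differentiable ℂ e) (hne : ∀ z, e z ≠ 0) :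
    ∃ G : ℂ → ℂ, Differentiable ℂ G ∧ ∀ z, e z = Complex.exp (G z) := by
  have hd : Differentiable ℂ (fun z ↦ deriv e z / e z) := by
    have := he.differentiableOn.deriv isOpen_univ
    exact (differentiableOn_univ.1 this).div he hne
  obtain ⟨G, hG, hG'⟩ := exists_eq_exp_of_isExactOn isOpen_univ isPreconnected_univ (Set.mem_univ _)
    he.differentiableOn (fun z _ ↦ hne z)
    ⟨fun w ↦ Complex.wedgeIntegral 0 w (fun z ↦ deriv e z / e z), fun z _ ↦
      Complex.IsConservativeOn.hasDerivAt_wedgeIntegral (r := ‖z‖ + 1) hd.continuous.continuousOn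
        (by simp) hd.differentiableOn.isConservativeOn⟩
  exact ⟨G, differentiableOn_univ.1 hG, fun z ↦ hG' z (Set.mem_univ _)⟩

lemma posLog_add_posLog_inv (x : ℝ) : log⁺ x + log⁺ x⁻¹ = |log x| := by
  rw [← half_mul_log_add_log_abs, ← half_mul_log_add_log_abs, log_inv, abs_neg]
  ring

lemma circleAverage_abs_log_norm {f : ℂ → ℂ} (hf : Meromorphic f) (R : ℝ) :
    circleAverage (fun z ↦ |log ‖f z‖|) 0 R = proximity f ⊤ R + proximity f⁻¹ ⊤ R := by
  rw [proximity_top, proximity_top, ← circleAverage_fun_add]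
  · simp only [Pi.inv_apply, norm_inv, posLog_add_posLog_inv]
  · exact (hf.meromorphicOn).circleIntegrable_posLog_norm
  · exact (hf.inv.meromorphicOn).circleIntegrable_posLog_norm

/-- One has `|log x| = 2 log⁺ x - log x`. The mean of `log⁺` is bounded by its maximum on the
circle, and the mean of `log ‖z - u‖` is non-negative by Jensen's formula since `R ≥ 1`. -/
lemma circleAverage_abs_log_norm_sub_le {u : ℂ} {R ρ : ℝ} (hR : 1 ≤ R) (hRρ : R ≤ ρ) (hu : ‖u‖ ≤ ρ) :
    circleAverage (fun z ↦ |log ‖z - u‖|) 0 R ≤ 2 * log (2 * ρ) := by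
  have hm : Meromorphic (fun z : ℂ ↦ z - u) := fun _ ↦ by fun_prop
  have hint : CircleIntegrable (fun z ↦ log⁺ ‖z - u‖) 0 R :=
    (hm.meromorphicOn).circleIntegrable_posLog_norm
  have hint' : CircleIntegrable (fun z ↦ log ‖z - u‖) 0 R :=
    (hm.meromorphicOn).circleIntegrable_log_norm
  have h1 : circleAverage (fun z ↦ log⁺ ‖z - u‖) 0 R ≤ log (2 * ρ) := by
    refine circleAverage_mono_on_of_le_circle hint fun z hz ↦ ?_
    have hz' : ‖z‖ = R := by simpa [abs_of_pos (by linarith : 0 < R)] using hz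
    have : ‖z - u‖ ≤ 2 * ρ := (norm_sub_le _ _).trans (by linarith)
    refine (posLog_le_posLog (norm_nonneg _) this).trans_eq (posLog_eq_log ?_)
    rw [abs_of_pos] <;> linarith
  have h2 : 0 ≤ circleAverage (fun z ↦ log ‖z - u‖) 0 R := by
    rw [circleAverage_log_norm_sub_const_eq_log_radius_add_posLog (by linarith)]
    exact add_nonneg (log_nonneg hR) posLog_nonneg
  have h3 : (fun z ↦ |log ‖z - u‖|) = fun z ↦ (2 : ℝ) • log⁺ ‖z - u‖ - log ‖z - u‖ := by
    ext z
    rw [← half_mul_log_add_log_abs, smul_eq_mul]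
    ring
  have hint2 : CircleIntegrable (fun z ↦ (2 : ℝ) • log⁺ ‖z - u‖) 0 R := hint.const_smul
  rw [h3, circleAverage_fun_sub hint2 hint', circleAverage_fun_smul, smul_eq_mul]
  linarith

/-- If `f = ∏ (z - u) ^ D u * e` then `log ‖e‖` is controlled in the mean by `f` and the number
of factors. -/
lemma circleAverage_abs_log_norm_le {f e : ℂ → ℂ} (hf : Meromorphic f) {R ρ : ℝ} (hR : 1 ≤ R)
    (hRρ : R ≤ ρ) {s : Finset ℂ} (hs : ∀ u ∈ s, ‖u‖ ≤ ρ) {D : ℂ → ℤ}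
    (hec : ContinuousOn e (sphere 0 R)) (hne : ∀ z ∈ sphere (0 : ℂ) R, e z ≠ 0)
    (hfe : f =ᶠ[codiscreteWithin (sphere 0 R)] fun z ↦ (∏ u ∈ s, (z - u) ^ D u) * e z) :
    circleAverage (fun z ↦ |log ‖e z‖|) 0 R ≤ proximity f ⊤ R + proximity f⁻¹ ⊤ R
      + (∑ u ∈ s, |(D u : ℝ)|) * (2 * log (2 * ρ)) := by
  have hR0 : |R| = R := abs_of_pos (by linarith)
  have hlint : ∀ u : ℂ, CircleIntegrable (fun z ↦ log ‖z - u‖) 0 R := fun u ↦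
    (show Meromorphic (fun z : ℂ ↦ z - u) from fun _ ↦ by fun_prop).meromorphicOn.circleIntegrable_log_norm
  have hfint : CircleIntegrable (fun z ↦ |log ‖f z‖|) 0 R :=
    CircleIntegrable.abs (hf.meromorphicOn).circleIntegrable_log_norm
  have hsint : ∀ u ∈ s, CircleIntegrable (fun z ↦ |(D u : ℝ)| • |log ‖z - u‖|) 0 R := fun u _ ↦
    CircleIntegrable.const_smul (CircleIntegrable.abs (hlint u))
  have heint : CircleIntegrable (fun z ↦ |log ‖e z‖|) 0 R := by
    refine ContinuousOn.circleIntegrable' ?_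
    rw [hR0]
    exact continuous_abs.comp_continuousOn (hec.norm.log fun z hz ↦ norm_ne_zero_iff.2 (hne z hz))
  have hle : circleAverage (fun z ↦ |log ‖e z‖|) 0 R
      ≤ circleAverage (fun z ↦ |log ‖f z‖| + ∑ u ∈ s, |(D u : ℝ)| • |log ‖z - u‖|) 0 R := by
    -- The bound from the factorization is known only off a discrete set. Replacing the left side by
    -- its minimum with the bound does not change the average and makes the inequality hold at every
    -- point.
    have hcongr : (fun z ↦ |log ‖e z‖|) =ᶠ[codiscreteWithin (sphere 0 |R|)] fun z ↦
        min (|log ‖e z‖|) (|log ‖f z‖| + ∑ u ∈ s, |(D u : ℝ)| • |log ‖z - u‖|) := by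
      rw [hR0]
      filter_upwards [hfe, self_mem_codiscreteWithin (sphere (0 : ℂ) R),
        compl_finite_mem_codiscreteWithin (s := sphere (0 : ℂ) R) s.finite_toSet] with z hz hzs hzn
      rw [eq_comm, min_eq_left]
      have hprod : ∀ u ∈ s, ‖z - u‖ ≠ 0 := by
        intro u hu h
        rw [norm_eq_zero, sub_eq_zero] at h
        exact hzn (h ▸ hu)
      have : log ‖e z‖ = log ‖f z‖ - ∑ u ∈ s, (D u : ℝ) * log ‖z - u‖ := by
        rw [hz, norm_mul, norm_prod, log_mul, log_prod]
        · simp [norm_zpow, log_zpow]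
        · intro u hu
          simpa [norm_zpow] using zpow_ne_zero _ (hprod u hu)
        · refine Finset.prod_ne_zero_iff.2 fun u hu ↦ ?_
          simpa [norm_zpow] using zpow_ne_zero _ (hprod u hu)
        · exact norm_ne_zero_iff.2 (hne z hzs)
      rw [this]
      refine (abs_sub _ _).trans (add_le_add le_rfl ((Finset.abs_sum_le_sum_abs _ _).trans_eq ?_))
      simp [abs_mul]
    rw [circleAverage_congr_codiscreteWithin hcongr (by linarith)]
    refine circleAverage_mono ?_ (hfint.add (CircleIntegrable.fun_sum s hsint)) fun z _ ↦
      min_le_right _ _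
    exact heint.congr_codiscreteWithin hcongr
  rw [circleAverage_fun_add hfint (CircleIntegrable.fun_sum s hsint), circleAverage_abs_log_norm hf,
    circleAverage_fun_sum hsint] at hle
  refine hle.trans (add_le_add le_rfl ?_)
  rw [Finset.sum_mul]
  refine Finset.sum_le_sum fun u hu ↦ ?_
  rw [circleAverage_fun_smul, smul_eq_mul]
  exact mul_le_mul_of_nonneg_left (circleAverage_abs_log_norm_sub_le hR hRρ (hs u hu)) (abs_nonneg _)

/-! ### The lemma on the logarithmic derivative -/

/-- A term `1 / (z - u)` is not integrable on circles through `u`, but its square root has uniformly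
bounded means. The exponent `2` outside costs only a factor under the logarithm. Integrality of `D
u` gives `|D u| ≤ |D u|²`. -/
lemma norm_le_sq_of_eq_sum {s : Finset ℂ} {D : ℂ → ℤ} {z w : ℂ} {B : ℝ} (hw : ‖w‖ ≤ B) :
    ‖(∑ u ∈ s, (D u : ℂ) / (z - u)) + w‖ ≤
      ((∑ u ∈ s, |(D u : ℝ)| * (√‖z - u‖)⁻¹) + √B) ^ 2 := by
  have hB : 0 ≤ B := (norm_nonneg _).trans hw
  have h1 : ‖∑ u ∈ s, (D u : ℂ) / (z - u)‖ ≤ ∑ u ∈ s, (|(D u : ℝ)| * (√‖z - u‖)⁻¹) ^ 2 := by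
    refine (norm_sum_le _ _).trans (Finset.sum_le_sum fun u _ ↦ ?_)
    rw [norm_div, mul_pow, inv_pow, sq_sqrt (norm_nonneg _), div_eq_mul_inv]
    refine mul_le_mul_of_nonneg_right ?_ (by positivity)
    have : ‖(D u : ℂ)‖ = |(D u : ℝ)| := by simp
    rw [this]
    have hint : |D u| ≤ |D u| ^ 2 := by
      rcases eq_or_ne (D u) 0 with h | h
      · simp [h]
      · have := Int.one_le_abs h
        nlinarith
    exact_mod_cast hint
  have h2 : ∑ u ∈ s, (|(D u : ℝ)| * (√‖z - u‖)⁻¹) ^ 2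
      ≤ (∑ u ∈ s, |(D u : ℝ)| * (√‖z - u‖)⁻¹) ^ 2 := by
    rw [sq (∑ u ∈ s, _), Finset.sum_mul]
    refine Finset.sum_le_sum fun u hu ↦ ?_
    rw [sq]
    refine mul_le_mul_of_nonneg_left ?_ (by positivity)
    exact Finset.single_le_sum (f := fun u ↦ |(D u : ℝ)| * (√‖z - u‖)⁻¹)
      (fun v _ ↦ by positivity) hu
  have h3 : 0 ≤ ∑ u ∈ s, |(D u : ℝ)| * (√‖z - u‖)⁻¹ := Finset.sum_nonneg fun u _ ↦ by positivity
  calc _ ≤ ‖∑ u ∈ s, (D u : ℂ) / (z - u)‖ + ‖w‖ := norm_add_le _ _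
    _ ≤ (∑ u ∈ s, |(D u : ℝ)| * (√‖z - u‖)⁻¹) ^ 2 + (√B) ^ 2 := by
        rw [sq_sqrt hB]; exact add_le_add (h1.trans h2) hw
    _ ≤ _ := by nlinarith [sqrt_nonneg B]

/-- The tangent line of a concave function. Averaging it replaces Jensen's inequality: a bound of
the mean of `v` by `A` bounds the mean of `log (1 + v)`. -/
lemma log_one_add_le_tangent {v A : ℝ} (hv : 0 ≤ v) (hA : 0 ≤ A) :
    log (1 + v) ≤ log (1 + A) + (v - A) / (1 + A) := by
  have h := log_le_sub_one_of_pos (x := (1 + v) / (1 + A)) (by positivity)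
  rw [log_div (by positivity) (by positivity)] at h
  have : (1 + v) / (1 + A) - 1 = (v - A) / (1 + A) := by field_simp; ring
  linarith

lemma logDeriv_prod_zpow_mul {s : Finset ℂ} {D : ℂ → ℤ} {e : ℂ → ℂ} {y : ℂ} (hy : y ∉ s)
    (he : DifferentiableAt ℂ e y) (hne : e y ≠ 0) :
    logDeriv (fun z ↦ (∏ u ∈ s, (z - u) ^ D u) * e z) y
      = (∑ u ∈ s, (D u : ℂ) / (y - u)) + logDeriv e y := by
  have hu : ∀ u ∈ s, y - u ≠ 0 := fun u hu h ↦ hy ((sub_eq_zero.1 h) ▸ hu)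
  have hd : ∀ u ∈ s, DifferentiableAt ℂ (fun z : ℂ ↦ (z - u) ^ D u) y := fun u h ↦
    DifferentiableAt.zpow (by fun_prop) (Or.inl (hu u h))
  rw [logDeriv_mul y (Finset.prod_ne_zero_iff.2 fun u h ↦ zpow_ne_zero _ (hu u h)) hne
    (DifferentiableAt.fun_finsetProd hd) he, logDeriv_prod (f := fun u z ↦ (z - u) ^ D u)
      (fun u h ↦ zpow_ne_zero _ (hu u h)) hd]
  congr 1
  refine Finset.sum_congr rfl fun u h ↦ ?_
  rw [logDeriv_fun_zpow (by fun_prop), logDeriv_apply, deriv_sub_const, deriv_id'']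
  rw [mul_one_div]

lemma sum_abs_divisor_le {g : ℂ → ℂ} {r R : ℝ} (hr : 1 ≤ r) (hrR : r < R)
    (s : Finset ℂ) (hs : ∀ a ∈ s, ‖a‖ ≤ r) :
    (∑ u ∈ s, |(MeromorphicOn.divisor g Set.univ u : ℝ)|) * log (R / r)
      ≤ logCounting g 0 R + logCounting g ⊤ R := by
  set D := MeromorphicOn.divisor g Set.univ with hD
  have h := sum_mul_log_le_logCounting (D := D⁺ + D⁻)
    (add_nonneg (posPart_nonneg _) (negPart_nonneg _)) hr hrR s hs
  rw [map_add, Pi.add_apply, hD, ← logCounting_zero, ← logCounting_top] at h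
  refine le_trans (le_of_eq ?_) h
  congr 1
  refine Finset.sum_congr rfl fun u _ ↦ ?_
  rw [Function.locallyFinsuppWithin.coe_add, Pi.add_apply,
    Function.locallyFinsuppWithin.posPart_apply, Function.locallyFinsuppWithin.negPart_apply,
    posPart_add_negPart, Int.cast_abs]

/-- The main estimate behind the lemma on the logarithmic derivative. -/
lemma proximity_logDeriv_le_aux {c : ℝ} (hc0 : 0 ≤ c)
    (hc : ∀ (a : ℂ) (r : ℝ), 1 ≤ r → CircleIntegrable (fun z ↦ (√‖z - a‖)⁻¹) 0 r ∧
      circleAverage (fun z ↦ (√‖z - a‖)⁻¹) 0 r ≤ c)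
    {g : ℂ → ℂ} (hg : Meromorphic g) (hnt : ∀ z, meromorphicOrderAt g z ≠ ⊤)
    {r R₁ R₂ R₃ N B : ℝ} (hr : 1 ≤ r) (h1 : r < R₁) (h2 : R₁ < R₂) (h3 : R₂ < R₃)
    (hN : logCounting g 0 R₃ + logCounting g ⊤ R₃ ≤ N * log (R₃ / R₂))
    (hB : 2 * R₁ / (R₁ - r) ^ 2 * (proximity g ⊤ R₁ + proximity g⁻¹ ⊤ R₁
      + N * (2 * log (2 * R₂))) ≤ B) :
    proximity (logDeriv g) ⊤ r ≤ 2 * log (1 + (N * c + √B)) := by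
  have hr0 : |r| = r := abs_of_pos (by linarith)
  set U : Set ℂ := closedBall 0 R₂ with hU
  set D := MeromorphicOn.divisor g U with hDdef
  have hfin : D.support.Finite := Function.locallyFinsuppWithin.finiteSupport _ (isCompact_closedBall 0 R₂)
  set s := hfin.toFinset with hs
  have hsU : ∀ u ∈ s, u ∈ U := fun u hu ↦ D.supportWithinDomain (hfin.mem_toFinset.1 hu)
  have hsn : ∀ u ∈ s, ‖u‖ ≤ R₂ := fun u hu ↦ by simpa [hU] using hsU u hu
  -- On the disk of radius `R₂` the zeros and poles are split off, leaving a zero-free `e`, so `g' /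
  -- g` is a finite sum of simple fractions plus `e' / e`. The circle of radius `R₁` carries the
  -- estimate for `e' / e`, and `R₃` serves to count the factors.
  obtain ⟨e, hea, hene, hge⟩ :=
    (hg.meromorphicOn (s := U)).extract_zeros_poles (fun u ↦ hnt u) hfin
  have hprod : (∏ᶠ u, (· - u) ^ D u : ℂ → ℂ) = fun z ↦ ∏ u ∈ s, (z - u) ^ D u := by
    rw [finprod_eq_prod_of_mulSupport_subset (s := s)]
    · ext z; simp
    · rw [Function.FactorizedRational.mulSupport]; simp [hs]
  have hge' : g =ᶠ[codiscreteWithin U] fun z ↦ (∏ u ∈ s, (z - u) ^ D u) * e z := by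
    rw [← hDdef, hprod] at hge
    exact hge
  have hloc : ∀ x ∈ ball (0 : ℂ) R₂, g =ᶠ[𝓝[≠] x] fun z ↦ (∏ u ∈ s, (z - u) ^ D u) * e z := by
    intro x hx
    have := (mem_codiscreteWithin_iff_forall_mem_nhdsNE.1 hge') x (ball_subset_closedBall hx)
    filter_upwards [this, mem_nhdsWithin_of_mem_nhds (isOpen_ball.mem_nhds hx)] with y hy hyb
    rcases hy with hy | hy
    · exact hy
    · exact absurd (ball_subset_closedBall hyb) hy
  have hsub : ball (0 : ℂ) R₂ ⊆ U := ball_subset_closedBall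
  have hed : DifferentiableOn ℂ e (ball 0 R₂) := fun z hz ↦
    (hea z (hsub hz)).differentiableAt.differentiableWithinAt
  have hen : ∀ z ∈ ball (0 : ℂ) R₂, e z ≠ 0 := fun z hz ↦ hene ⟨z, hsub hz⟩
  set W : ℂ → ℂ := fun z ↦ (∑ u ∈ s, (D u : ℂ) / (z - u)) + logDeriv e z with hW
  have hlogW : logDeriv g =ᶠ[codiscreteWithin (sphere 0 |r|)] W := by
    refine mem_codiscreteWithin_iff_forall_mem_nhdsNE.2 fun x hx ↦ mem_of_superset ?_ Set.subset_union_left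
    have hxb : x ∈ ball (0 : ℂ) R₂ := by
      simp only [hr0, mem_sphere, dist_zero_right] at hx
      simp; linarith
    have hd := (hloc x hxb).nhdsNE_deriv
    have hns : ∀ᶠ y in 𝓝[≠] x, y ∉ s := by
      have := compl_finite_mem_codiscreteWithin (s := (Set.univ : Set ℂ)) s.finite_toSet
      have := (mem_codiscreteWithin_iff_forall_mem_nhdsNE.1 this) x (Set.mem_univ _)
      rw [Set.compl_univ, Set.union_empty] at this
      exact this
    filter_upwards [hloc x hxb, hd, hns, mem_nhdsWithin_of_mem_nhds (isOpen_ball.mem_nhds hxb)]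
      with y hy1 hy2 hy3 hy4
    simp only [hW]
    rw [← logDeriv_prod_zpow_mul hy3 (hed.differentiableAt (isOpen_ball.mem_nhds hy4)) (hen y hy4),
      logDeriv_apply, logDeriv_apply, hy2, hy1]
  have hR1 : (1 : ℝ) ≤ R₁ := by linarith
  have hDsum : ∑ u ∈ s, |(D u : ℝ)| ≤ N := by
    have h := sum_abs_divisor_le (g := g) (by linarith : 1 ≤ R₂) h3 s hsn
    have hlog : 0 < log (R₃ / R₂) := log_pos (by rw [lt_div_iff₀] <;> linarith)
    have h' : ∑ u ∈ s, |(D u : ℝ)| = ∑ u ∈ s, |(MeromorphicOn.divisor g Set.univ u : ℝ)| := by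
      refine Finset.sum_congr rfl fun u hu ↦ ?_
      rw [hDdef, MeromorphicOn.divisor_apply hg.meromorphicOn (hsU u hu),
        MeromorphicOn.divisor_apply hg.meromorphicOn (Set.mem_univ u)]
    rw [h']
    exact le_of_mul_le_mul_right (h.trans hN) hlog
  -- Here `e' / e = G'`, and `Re G = log ‖e‖` has a controlled mean on the circle of radius `R₁`.
  obtain ⟨G, hGd, hG⟩ := exists_eq_exp_on_ball (by linarith) hed hen
  have hlogd : ∀ z, ‖z‖ = r → ‖logDeriv e z‖ ≤ B := by
    intro z hz
    have hzb : z ∈ ball (0 : ℂ) R₂ := by simp; linarith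
    have heq : logDeriv e z = deriv G z := by
      have hev : e =ᶠ[𝓝 z] fun w ↦ Complex.exp (G w) := by
        filter_upwards [isOpen_ball.mem_nhds hzb] with w hw using hG w hw
      rw [logDeriv_apply, hev.deriv_eq, hG z hzb,
        ((hGd.differentiableAt (isOpen_ball.mem_nhds hzb)).hasDerivAt.cexp).deriv]
      field_simp
    have hS := norm_deriv_le_circleAverage_abs_re hGd h2 (by rw [hz]; exact h1)
    rw [hz] at hS
    rw [heq]
    refine hS.trans (le_trans ?_ hB)
    refine mul_le_mul_of_nonneg_left ?_ (by positivity)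
    have hsph : sphere (0 : ℂ) R₁ ⊆ ball 0 R₂ := sphere_subset_closedBall.trans (closedBall_subset_ball h2)
    have hre : circleAverage (fun w ↦ |(G w).re|) 0 R₁ = circleAverage (fun w ↦ |log ‖e w‖|) 0 R₁ := by
      refine circleAverage_congr_sphere fun w hw ↦ ?_
      rw [abs_of_pos (by linarith : 0 < R₁)] at hw
      rw [hG w (hsph hw), Complex.norm_exp, log_exp]
    rw [hre]
    refine (circleAverage_abs_log_norm_le hg hR1 h2.le hsn
      (hed.continuousOn.mono hsph) (fun w hw ↦ hen w (hsph hw))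
      (hge'.filter_mono (codiscreteWithin_mono (hsph.trans hsub)))).trans ?_
    refine add_le_add le_rfl (mul_le_mul_of_nonneg_right hDsum ?_)
    exact mul_nonneg zero_le_two (log_nonneg (by linarith : 1 ≤ 2 * R₂))
  have hN0 : 0 ≤ N := (Finset.sum_nonneg fun u _ ↦ abs_nonneg _).trans hDsum
  set A := N * c + √B with hA
  have hA0 : 0 ≤ A := by positivity
  set v : ℂ → ℝ := fun z ↦ (∑ u ∈ s, |(D u : ℝ)| • (√‖z - u‖)⁻¹) + √B with hv
  have hvint' : ∀ u ∈ s, CircleIntegrable (fun z ↦ |(D u : ℝ)| • (√‖z - u‖)⁻¹) 0 r := fun u _ ↦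
    CircleIntegrable.const_smul (hc u r hr).1
  have hvint : CircleIntegrable v 0 r :=
    (CircleIntegrable.fun_sum s hvint').add (circleIntegrable_const _ _ _)
  have hvavg : circleAverage v 0 r ≤ A := by
    rw [hv, circleAverage_fun_add (CircleIntegrable.fun_sum s hvint') (circleIntegrable_const _ _ _),
      circleAverage_fun_sum hvint', circleAverage_const]
    refine add_le_add ?_ le_rfl
    refine le_trans ?_ (mul_le_mul_of_nonneg_right hDsum hc0)
    rw [Finset.sum_mul]
    refine Finset.sum_le_sum fun u hu ↦ ?_
    rw [circleAverage_fun_smul, smul_eq_mul]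
    exact mul_le_mul_of_nonneg_left (hc u r hr).2 (abs_nonneg _)
  have hWint : CircleIntegrable (fun z ↦ log⁺ ‖W z‖) 0 r := by
    refine CircleIntegrable.congr_codiscreteWithin ?_
      (hg.logDeriv.meromorphicOn).circleIntegrable_posLog_norm
    filter_upwards [hlogW] with z hz
    rw [hz]
  rw [proximity_congr_codiscreteWithin hlogW (by linarith), proximity_top]
  -- The integrand is bounded by the tangent at `A` of `2 log (1 + ·)`, evaluated at `v z`. As the
  -- mean of `v` is at most `A`, the linear correction has non-positive mean.
  have hmono : circleAverage (fun z ↦ log⁺ ‖W z‖) 0 r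
      ≤ circleAverage (fun z ↦ (2 * log (1 + A) - 2 * A / (1 + A)) + (2 / (1 + A)) • v z) 0 r := by
    refine circleAverage_mono hWint ((circleIntegrable_const _ _ _).add hvint.const_smul) fun z hz ↦ ?_
    have hz' : ‖z‖ = r := by simpa [hr0] using hz
    have hv0 : 0 ≤ v z := add_nonneg (Finset.sum_nonneg fun u _ ↦ by positivity) (sqrt_nonneg _)
    have hWv : ‖W z‖ ≤ (1 + v z) ^ 2 :=
      (norm_le_sq_of_eq_sum (hlogd z hz')).trans (by
        change v z ^ 2 ≤ _
        nlinarith)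
    calc log⁺ ‖W z‖ ≤ log⁺ ((1 + v z) ^ 2) := posLog_le_posLog (norm_nonneg _) hWv
      _ = 2 * log (1 + v z) := by
        rw [posLog_pow, posLog_eq_log (by rw [abs_of_nonneg] <;> linarith)]
        norm_num
      _ ≤ 2 * (log (1 + A) + (v z - A) / (1 + A)) := by
        linarith [log_one_add_le_tangent hv0 hA0]
      _ = _ := by rw [smul_eq_mul]; ring
  refine hmono.trans ?_
  have hvint2 : CircleIntegrable (fun z ↦ (2 / (1 + A)) • v z) 0 r := hvint.const_smul
  rw [circleAverage_fun_add (circleIntegrable_const _ _ _) hvint2, circleAverage_const,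
    circleAverage_fun_smul, smul_eq_mul]
  have : 2 / (1 + A) * circleAverage v 0 r ≤ 2 / (1 + A) * A :=
    mul_le_mul_of_nonneg_left hvavg (by positivity)
  have h' : 2 / (1 + A) * A = 2 * A / (1 + A) := by ring
  linarith

lemma T_nonneg {g : ℂ → ℂ} {r : ℝ} (hr : 1 ≤ r) : 0 ≤ T g r := characteristic_nonneg hr

lemma T_monotoneOn {g : ℂ → ℂ} (hg : Meromorphic g) : MonotoneOn (T g) (Set.Ioi 0) :=
  characteristic_monotoneOn hg

lemma T_inv {g : ℂ → ℂ} (hg : Meromorphic g) {r : ℝ} (hr : r ≠ 0) :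
    T g⁻¹ r = T g r - log ‖meromorphicTrailingCoeffAt g 0‖ := by
  have := characteristic_sub_characteristic_inv_of_ne_zero hg hr
  simp only [T]
  linarith

lemma proximity_add_proximity_inv_add_logCounting {g : ℂ → ℂ} (r : ℝ) :
    (proximity g ⊤ r + proximity g⁻¹ ⊤ r) + (logCounting g 0 r + logCounting g ⊤ r)
      = T g r + T g⁻¹ r := by
  simp only [T, characteristic, Pi.add_apply, ← logCounting_inv]
  ring

lemma one_le_sq_mul_sq {t x : ℝ} (ht : 1 ≤ t) (hx : 1 ≤ x) : t ≤ t ^ 2 * x ^ 2 := by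
  have h1 : 1 ≤ x ^ 2 := one_le_pow₀ hx
  have h2 : t * 1 ≤ t * t := mul_le_mul_of_nonneg_left ht (by linarith)
  have h3 : t ^ 2 * 1 ≤ t ^ 2 * x ^ 2 := mul_le_mul_of_nonneg_left h1 (sq_nonneg t)
  have h4 : t ^ 2 = t * t := sq t
  linarith

lemma radius_quotient_le {t δ r : ℝ} (ht : 1 ≤ t) (hδ : δ = (3 * t)⁻¹) (h1 : δ ≤ 1) :
    2 * (r + δ) / (r + δ - r) ^ 2 ≤ 18 * t ^ 2 * (r + 1) := by
  have h0 : 0 ≤ t := by linarith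
  have : 2 * (r + δ) / (r + δ - r) ^ 2 = 18 * t ^ 2 * (r + δ) := by
    rw [add_sub_cancel_left, hδ, inv_pow, div_inv_eq_mul]
    ring
  rw [this]
  gcongr

lemma energy_le {t m l x : ℝ} (ht : 1 ≤ t) (hx : 1 ≤ x) (hm : m ≤ 2 * t) (hl : l ≤ 2 * x) :
    m + 6 * t ^ 2 * x * (2 * l) ≤ 26 * t ^ 2 * x ^ 2 := by
  have h1 : 6 * t ^ 2 * x * (2 * l) ≤ 6 * t ^ 2 * x * (2 * (2 * x)) := by gcongr
  have h2 := one_le_sq_mul_sq ht hx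
  have h3 : 6 * t ^ 2 * x * (2 * (2 * x)) = 24 * (t ^ 2 * x ^ 2) := by ring
  linarith

lemma one_add_le_sq_mul_sq {t c x : ℝ} (ht : 1 ≤ t) (hx : 1 ≤ x) (hc : 0 ≤ c) :
    1 + (6 * t ^ 2 * x * c + 22 * t ^ 2 * x ^ 2) ≤ (23 + 6 * c) * (t ^ 2 * x ^ 2) := by
  have h1 := one_le_sq_mul_sq ht hx
  have h2 : x ≤ x ^ 2 := by
    have := one_le_sq_mul_sq hx le_rfl
    simpa using this
  have h3 : t ^ 2 * x * c ≤ t ^ 2 * x ^ 2 * c := by gcongr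
  linarith

/-- The **lemma on the logarithmic derivative**. -/
theorem exists_proximity_logDeriv_le {g : ℂ → ℂ} (hg : Meromorphic g)
    (hnt : ∀ z, meromorphicOrderAt g z ≠ ⊤) : ∃ K : ℝ, ∀ᶠ r in exceptional,
      proximity (logDeriv g) ⊤ r ≤ K + 4 * log (T g r + T g⁻¹ r + 1) + 4 * log (r + 1) := by
  obtain ⟨c, hc0, hc⟩ := exists_circleAverage_inv_sqrt_norm_sub_le
  set τ : ℝ → ℝ := fun r ↦ T g r + T g⁻¹ r + 1 with hτ
  have hmono : MonotoneOn τ (Set.Ici 1) := by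
    intro a ha b hb hab
    have ha' : a ∈ Set.Ioi (0 : ℝ) := lt_of_lt_of_le zero_lt_one (Set.mem_Ici.1 ha)
    have hb' : b ∈ Set.Ioi (0 : ℝ) := lt_of_lt_of_le zero_lt_one (Set.mem_Ici.1 hb)
    have h1 := T_monotoneOn hg ha' hb' hab
    have h2 := T_monotoneOn hg.inv ha' hb' hab
    simp only [hτ]
    linarith
  have hτ1 : ∀ r, 1 ≤ r → 1 ≤ τ r := fun r hr ↦ by
    have h1 := T_nonneg (g := g) hr
    have h2 := T_nonneg (g := g⁻¹) hr
    simp only [hτ]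
    linarith
  refine ⟨2 * log (23 + 6 * c), ?_⟩
  filter_upwards [eventually_apply_add_inv_le hmono hτ1, mem_inf_of_left (Ici_mem_atTop (1 : ℝ))]
    with r hgrow hr1
  have hr : 1 ≤ r := hr1
  have ht : 1 ≤ τ r := hτ1 r hr
  set t := τ r with htdef
  -- Three steps of length `δ` fill the interval of length `1 / τ r` on which Borel's lemma keeps
  -- the total characteristic below `2 t`. The radii `R₁, R₂, R₃` are `r + δ, r + 2δ, r + 3δ`.
  set δ := (3 * t)⁻¹ with hδ
  have hδ0 : 0 < δ := by positivity
  have h3δ : 3 * δ = t⁻¹ := by rw [hδ, mul_inv]; ring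
  have hδ1 : t⁻¹ ≤ 1 := inv_le_one_of_one_le₀ ht
  have hbig : ∀ R, r ≤ R → R ≤ r + t⁻¹ → τ R ≤ 2 * t := fun R h1 h2 ↦
    (hmono (by simp only [Set.mem_Ici]; linarith) (by simp only [Set.mem_Ici]; linarith) h2).trans hgrow
  have hcount : logCounting g 0 (r + 3 * δ) + logCounting g ⊤ (r + 3 * δ) ≤ 2 * t := by
    have h1 := hbig (r + 3 * δ) (by linarith) (by rw [h3δ])
    have h2 := proximity_add_proximity_inv_add_logCounting (g := g) (r + 3 * δ)
    have h3 := proximity_nonneg (f := g) (a := ⊤) (r + 3 * δ)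
    have h4 := proximity_nonneg (f := g⁻¹) (a := ⊤) (r + 3 * δ)
    simp only [hτ, Pi.zero_apply] at h1 h3 h4
    linarith
  have hprox : proximity g ⊤ (r + δ) + proximity g⁻¹ ⊤ (r + δ) ≤ 2 * t := by
    have h1 := hbig (r + δ) (by linarith) (by linarith)
    have h2 := proximity_add_proximity_inv_add_logCounting (g := g) (r + δ)
    have h3 := logCounting_nonneg (f := g) (e := ⊤) (by linarith : 1 ≤ r + δ)
    have h4 := logCounting_nonneg (f := g) (e := 0) (by linarith : 1 ≤ r + δ)
    simp only [hτ] at h1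
    linarith
  -- Chosen so that `N · δ / (r + 1) = 2 t`, while `δ / (r + 1)` is a lower bound for `log (R₃ /
  -- R₂)`.
  set N := 6 * t ^ 2 * (r + 1) with hNdef
  have hN : logCounting g 0 (r + 3 * δ) + logCounting g ⊤ (r + 3 * δ)
      ≤ N * log ((r + 3 * δ) / (r + 2 * δ)) := by
    refine hcount.trans ?_
    have hlog := one_sub_inv_le_log_of_pos (x := (r + 3 * δ) / (r + 2 * δ)) (by positivity)
    have h1 : 1 - ((r + 3 * δ) / (r + 2 * δ))⁻¹ = δ / (r + 3 * δ) := by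
      rw [inv_div, eq_div_iff (by positivity), sub_mul, div_mul_cancel₀ _ (by positivity)]
      ring
    have h2 : δ / (r + 1) ≤ δ / (r + 3 * δ) := by gcongr; linarith
    calc 2 * t = N * (δ / (r + 1)) := by rw [hNdef, hδ]; field_simp; norm_num
      _ ≤ N * log ((r + 3 * δ) / (r + 2 * δ)) := by gcongr; linarith
  -- A perfect square, so that `√B` is explicit; `22² = 484` exceeds `18 · 26 = 468`, the product of
  -- the two constants below.
  set B := (22 * t ^ 2 * (r + 1) ^ 2) ^ 2 with hBdef
  have hB : 2 * (r + δ) / (r + δ - r) ^ 2 * (proximity g ⊤ (r + δ) + proximity g⁻¹ ⊤ (r + δ)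
      + N * (2 * log (2 * (r + 2 * δ)))) ≤ B := by
    have hl : log (2 * (r + 2 * δ)) ≤ 2 * (r + 1) :=
      (log_le_self (by positivity)).trans (by linarith)
    have hq : 2 * (r + δ) / (r + δ - r) ^ 2 ≤ 18 * t ^ 2 * (r + 1) :=
      radius_quotient_le ht hδ (by linarith)
    have hs : proximity g ⊤ (r + δ) + proximity g⁻¹ ⊤ (r + δ)
        + N * (2 * log (2 * (r + 2 * δ))) ≤ 26 * t ^ 2 * (r + 1) ^ 2 :=
      energy_le ht (by linarith) hprox hl
    have hs0 : 0 ≤ proximity g ⊤ (r + δ) + proximity g⁻¹ ⊤ (r + δ)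
        + N * (2 * log (2 * (r + 2 * δ))) := by
      have h3 := proximity_nonneg (f := g) (a := ⊤) (r + δ)
      have h4 := proximity_nonneg (f := g⁻¹) (a := ⊤) (r + δ)
      simp only [Pi.zero_apply] at h3 h4
      have : 0 ≤ log (2 * (r + 2 * δ)) := log_nonneg (by linarith)
      positivity
    calc _ ≤ 18 * t ^ 2 * (r + 1) * (26 * t ^ 2 * (r + 1) ^ 2) := by gcongr
      _ = 468 * (t ^ 4 * (r + 1) ^ 3) := by ring
      _ ≤ 484 * (t ^ 4 * (r + 1) ^ 4) := by
        have : (r + 1) ^ 3 ≤ (r + 1) ^ 4 := pow_le_pow_right₀ (by linarith) (by norm_num)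
        gcongr
        norm_num
      _ = B := by rw [hBdef]; ring
  have main := proximity_logDeriv_le_aux hc0 hc hg hnt hr (by linarith : r < r + δ)
    (by linarith : r + δ < r + 2 * δ) (by linarith : r + 2 * δ < r + 3 * δ) hN hB
  refine main.trans ?_
  have hsq : √B = 22 * t ^ 2 * (r + 1) ^ 2 := by rw [hBdef, sqrt_sq (by positivity)]
  have harg : 1 + (N * c + √B) ≤ (23 + 6 * c) * (t ^ 2 * (r + 1) ^ 2) := by
    rw [hsq, hNdef]
    exact one_add_le_sq_mul_sq ht (by linarith) hc0
  have hN0 : 0 ≤ N := by positivity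
  have hl := log_le_log (by positivity) harg
  rw [log_mul (by positivity) (by positivity), log_mul (by positivity) (by positivity), log_pow,
    log_pow] at hl
  push_cast at hl
  linarith

/-! ### Logarithmic derivatives measured against a fixed characteristic -/

section SmallFunctions

variable {f : ℂ → ℂ}

lemma tendsto_T_atTop (hlog : log =o[atTop] T f) : Tendsto (T f) atTop atTop := by
  refine tendsto_atTop_mono' _ ?_ tendsto_log_atTop
  filter_upwards [hlog.bound (zero_lt_one' ℝ), eventually_ge_atTop 1] with r h hr
  rw [one_mul, Real.norm_of_nonneg (T_nonneg hr)] at h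
  exact (le_abs_self _).trans h

lemma isLittleO_const_T (hlog : log =o[atTop] T f) (c : ℝ) :
    (fun _ : ℝ ↦ c) =o[exceptional] T f :=
  (Asymptotics.isLittleO_const_left.2
    (Or.inr (tendsto_norm_atTop_atTop.comp (tendsto_T_atTop hlog)))).mono inf_le_left

lemma isBigO_T_inv (hlog : log =o[atTop] T f) {g : ℂ → ℂ} (hg : Meromorphic g)
    (hgT : T g =O[exceptional] T f) : T g⁻¹ =O[exceptional] T f := by
  refine (hgT.sub (isLittleO_const_T hlog (log ‖meromorphicTrailingCoeffAt g 0‖)).isBigO).congr' ?_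
    EventuallyEq.rfl
  filter_upwards [mem_inf_of_left (Ioi_mem_atTop (0 : ℝ))] with r hr
  exact (T_inv hg (ne_of_gt hr)).symm

/-- Since `T g = O(T f)`, the error terms are `O(1 + log T f + log r)`, all of which are `o(T f)`.
Measuring against `f` rather than `g` allows many functions `g` to be handled with one error term.
-/
theorem proximity_logDeriv_isLittleO (hlog : log =o[atTop] T f) {g : ℂ → ℂ} (hg : Meromorphic g)
    (hnt : ∀ z, meromorphicOrderAt g z ≠ ⊤) (hgT : T g =O[exceptional] T f) :
    proximity (logDeriv g) ⊤ =o[exceptional] T f := by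
  obtain ⟨K, hK⟩ := exists_proximity_logDeriv_le hg hnt
  have hτ : (fun r ↦ T g r + T g⁻¹ r + 1) =O[exceptional] T f :=
    (hgT.add (isBigO_T_inv hlog hg hgT)).add (isLittleO_const_T hlog 1).isBigO
  have hTtop : Tendsto (T f) exceptional atTop := (tendsto_T_atTop hlog).mono_left inf_le_left
  have hlogT : (fun r ↦ log (T f r)) =o[exceptional] T f :=
    Real.isLittleO_log_id_atTop.comp_tendsto hTtop
  obtain ⟨C, hC0, hC⟩ := hτ.exists_pos
  have h1 : (fun r ↦ log (T g r + T g⁻¹ r + 1)) =o[exceptional] T f := by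
    refine Asymptotics.IsBigO.trans_isLittleO ?_ ((isLittleO_const_T hlog (|log C|)).add hlogT)
    refine Asymptotics.IsBigO.of_bound 1 ?_
    filter_upwards [hC.bound, mem_inf_of_left (Ici_mem_atTop (1 : ℝ)), hTtop.eventually_ge_atTop 1]
      with r hr hr1 hr2
    have h1 := T_nonneg (g := g) hr1
    have h2 := T_nonneg (g := g⁻¹) hr1
    rw [Real.norm_of_nonneg (by linarith), Real.norm_of_nonneg (by linarith)] at hr
    have h3 : 0 ≤ log (T g r + T g⁻¹ r + 1) := log_nonneg (by linarith)
    have h4 : 0 ≤ log (T f r) := log_nonneg hr2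
    have h5 := log_le_log (by linarith) hr
    rw [log_mul hC0.ne' (by linarith)] at h5
    rw [one_mul, Real.norm_of_nonneg h3, Real.norm_of_nonneg (by positivity)]
    linarith [le_abs_self (log C)]
  have h2 : (fun r ↦ log (r + 1)) =o[exceptional] T f := by
    have hb : (fun r : ℝ ↦ log (r + 1)) =O[exceptional] fun r ↦ log r + log 2 := by
      refine Asymptotics.IsBigO.of_bound 1 ?_
      filter_upwards [mem_inf_of_left (Ici_mem_atTop (1 : ℝ))] with r hr
      have hr' : (1 : ℝ) ≤ r := hr
      have hl : log (r + 1) ≤ log r + log 2 := by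
        rw [← log_mul (by linarith) (by norm_num)]
        exact log_le_log (by linarith) (by linarith)
      have h0 : 0 ≤ log (r + 1) := log_nonneg (by linarith)
      rw [one_mul, Real.norm_of_nonneg h0, Real.norm_of_nonneg (h0.trans hl)]
      exact hl
    exact hb.trans_isLittleO ((hlog.mono inf_le_left).add (isLittleO_const_T hlog _))
  refine Asymptotics.IsBigO.trans_isLittleO (Asymptotics.IsBigO.of_bound 1 ?_)
    (((isLittleO_const_T hlog K).add (h1.const_mul_left 4)).add (h2.const_mul_left 4))
  filter_upwards [hK] with r hr
  rw [one_mul, Real.norm_of_nonneg (proximity_nonneg r)]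
  exact hr.trans (le_abs_self _)

end SmallFunctions

/-! ### Elementary rules for the characteristic; rational functions -/

/-- The identity theorem: on the connected plane, infinite order at one point propagates to all
points. -/
lemma eventuallyEq_zero_or_forall_order_ne_top {g : ℂ → ℂ} (hg : Meromorphic g) :
    g =ᶠ[codiscrete ℂ] 0 ∨ ∀ z, meromorphicOrderAt g z ≠ ⊤ := by
  by_cases h : ∃ z, meromorphicOrderAt g z ≠ ⊤
  · exact Or.inr (hg.exists_meromorphicOrderAt_ne_top_iff_forall.1 h)
  · push Not at h
    left
    refine mem_codiscreteWithin_iff_forall_mem_nhdsNE.2 fun z _ ↦ ?_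
    filter_upwards [meromorphicOrderAt_eq_top_iff.1 (h z)] with w hw
    exact Or.inl hw

lemma T_congr {g₁ g₂ : ℂ → ℂ} (h : g₁ =ᶠ[codiscrete ℂ] g₂) {r : ℝ} (hr : r ≠ 0) :
    T g₁ r = T g₂ r := characteristic_congr_codiscrete h hr

lemma T_zero : T (0 : ℂ → ℂ) = 0 := by
  ext r
  simp [T, characteristic, Pi.zero_def]

lemma T_mul_le {g₁ g₂ : ℂ → ℂ} {r : ℝ} (hr : 1 ≤ r) (h₁ : Meromorphic g₁) (h₂ : Meromorphic g₂) :
    T (g₁ * g₂) r ≤ T g₁ r + T g₂ r := by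
  have hr0 : r ≠ 0 := by linarith
  have hnn := add_nonneg (T_nonneg (g := g₁) hr) (T_nonneg (g := g₂) hr)
  rcases eventuallyEq_zero_or_forall_order_ne_top h₁ with h | h1
  · have : g₁ * g₂ =ᶠ[codiscrete ℂ] 0 := by
      filter_upwards [h] with z hz
      simp [hz]
    rwa [T_congr this hr0, T_zero]
  rcases eventuallyEq_zero_or_forall_order_ne_top h₂ with h | h2
  · have : g₁ * g₂ =ᶠ[codiscrete ℂ] 0 := by
      filter_upwards [h] with z hz
      simp [hz]
    rwa [T_congr this hr0, T_zero]
  exact characteristic_mul_top_le hr h₁ h1 h₂ h2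

lemma T_add_le {g₁ g₂ : ℂ → ℂ} {r : ℝ} (hr : 1 ≤ r) (h₁ : Meromorphic g₁) (h₂ : Meromorphic g₂) :
    T (g₁ + g₂) r ≤ T g₁ r + T g₂ r + log 2 :=
  characteristic_add_top_le h₁ h₂ hr

lemma ratEval_eq_div (q : RatFunc ℂ) (z : ℂ) : ratEval q z = q.num.eval z / q.denom.eval z := by
  simp [ratEval, RatFunc.eval, Polynomial.eval₂_id]

lemma analyticAt_polynomial (a : Polynomial ℂ) (z : ℂ) : AnalyticAt ℂ (fun z ↦ a.eval z) z :=
  a.differentiable.analyticAt z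

lemma meromorphic_ratEval (q : RatFunc ℂ) : Meromorphic (ratEval q) := by
  have : ratEval q = (fun z ↦ q.num.eval z) / fun z ↦ q.denom.eval z :=
    funext fun z ↦ ratEval_eq_div q z
  rw [this]
  exact fun z ↦ (analyticAt_polynomial _ z).meromorphicAt.div (analyticAt_polynomial _ z).meromorphicAt

lemma analyticAt_ratEval {q : RatFunc ℂ} {z : ℂ} (hz : q.denom.eval z ≠ 0) :
    AnalyticAt ℂ (ratEval q) z := by
  have : ratEval q = (fun z ↦ q.num.eval z) / fun z ↦ q.denom.eval z :=
    funext fun z ↦ ratEval_eq_div q z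
  rw [this]
  exact (analyticAt_polynomial _ z).div (analyticAt_polynomial _ z) hz

lemma finite_denom_eval_eq_zero (q : RatFunc ℂ) : {z | q.denom.eval z = 0}.Finite :=
  (Polynomial.finite_setOfPred_isRoot q.denom_ne_zero :)

lemma ratEval_algebraMap_div (a : Polynomial ℂ) {b : Polynomial ℂ} (hb : b ≠ 0) :
    ratEval (algebraMap _ _ a / algebraMap _ _ b) =ᶠ[codiscrete ℂ]
      fun z ↦ a.eval z / b.eval z := by
  set q : RatFunc ℂ := algebraMap _ _ a / algebraMap _ _ b with hq
  have h := (RatFunc.num_mul_eq_mul_denom_iff (x := q) (p := a) hb).2 hq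
  have hfin := (finite_denom_eval_eq_zero q).union (Polynomial.finite_setOfPred_isRoot hb)
  filter_upwards [hfin.compl_mem_codiscrete] with z hz
  simp only [Set.mem_compl_iff, Set.mem_union, Set.mem_ofPred_eq, not_or, Polynomial.IsRoot.def] at hz
  rw [ratEval_eq_div, div_eq_div_iff hz.1 hz.2]
  simpa using congrArg (Polynomial.eval z) h

lemma exists_ratEval_eq_prod_zpow (s : Finset ℂ) (D : ℂ → ℤ) : ∃ q : RatFunc ℂ, q ≠ 0 ∧
    ratEval q =ᶠ[codiscrete ℂ] fun z ↦ ∏ u ∈ s, (z - u) ^ D u := by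
  set a : Polynomial ℂ := ∏ u ∈ s, (Polynomial.X - Polynomial.C u) ^ (D u).toNat
  set b : Polynomial ℂ := ∏ u ∈ s, (Polynomial.X - Polynomial.C u) ^ (-D u).toNat
  have ha : a ≠ 0 := Finset.prod_ne_zero_iff.2 fun u _ ↦ pow_ne_zero _ (Polynomial.X_sub_C_ne_zero u)
  have hb : b ≠ 0 := Finset.prod_ne_zero_iff.2 fun u _ ↦ pow_ne_zero _ (Polynomial.X_sub_C_ne_zero u)
  refine ⟨algebraMap _ _ a / algebraMap _ _ b, div_ne_zero (RatFunc.algebraMap_ne_zero ha)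
    (RatFunc.algebraMap_ne_zero hb), (ratEval_algebraMap_div a hb).trans (Eventually.of_forall ?_)⟩
  intro z
  simp only [a, b, Polynomial.eval_prod, Polynomial.eval_pow, Polynomial.eval_sub,
    Polynomial.eval_X, Polynomial.eval_C]
  rw [← Finset.prod_div_distrib]
  refine Finset.prod_congr rfl fun u _ ↦ ?_
  rcases le_total 0 (D u) with h | h
  · rw [Int.toNat_of_nonpos (neg_nonpos.2 h), pow_zero, div_one, ← zpow_natCast, Int.toNat_of_nonneg h]
  · rw [Int.toNat_of_nonpos h, pow_zero, one_div, ← zpow_natCast,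
      Int.toNat_of_nonneg (neg_nonneg.2 h), zpow_neg, inv_inv]

lemma T_eq_proximity_of_differentiable {g : ℂ → ℂ} (hg : Differentiable ℂ g) :
    T g = proximity g ⊤ := by
  have h0 : 0 ≤ MeromorphicOn.divisor g Set.univ :=
    MeromorphicOn.AnalyticOnNhd.divisor_nonneg fun z _ ↦ hg.analyticAt z
  have : logCounting g ⊤ = 0 := by
    rw [logCounting_top, negPart_eq_zero.2 h0, map_zero]
  rw [T, characteristic, this, add_zero]

lemma exists_norm_eval_le (a : Polynomial ℂ) : ∃ C : ℝ, 1 ≤ C ∧ ∀ z : ℂ, 1 ≤ ‖z‖ →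
    ‖a.eval z‖ ≤ C * ‖z‖ ^ a.natDegree := by
  refine ⟨1 + ∑ i ∈ Finset.range (a.natDegree + 1), ‖a.coeff i‖,
    le_add_of_nonneg_right (Finset.sum_nonneg fun _ _ ↦ norm_nonneg _), fun z hz ↦ ?_⟩
  rw [Polynomial.eval_eq_sum_range]
  refine (norm_sum_le _ _).trans ?_
  have h1 : ∑ i ∈ Finset.range (a.natDegree + 1), ‖a.coeff i * z ^ i‖
      ≤ (∑ i ∈ Finset.range (a.natDegree + 1), ‖a.coeff i‖) * ‖z‖ ^ a.natDegree := by
    rw [Finset.sum_mul]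
    refine Finset.sum_le_sum fun i hi ↦ ?_
    rw [norm_mul, norm_pow]
    gcongr
    exact Finset.mem_range_succ_iff.1 hi
  refine h1.trans ?_
  gcongr
  linarith

lemma T_polynomial_isBigO_log (a : Polynomial ℂ) : T (fun z ↦ a.eval z) =O[atTop] log := by
  obtain ⟨C, hC1, hC⟩ := exists_norm_eval_le a
  have hb : T (fun z ↦ a.eval z) =O[atTop] fun r ↦ log C + a.natDegree * log r := by
    refine Asymptotics.IsBigO.of_bound 1 ?_
    filter_upwards [eventually_ge_atTop 1] with r hr
    have h0 : 0 ≤ log C + a.natDegree * log r :=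
      add_nonneg (log_nonneg hC1) (mul_nonneg (Nat.cast_nonneg _) (log_nonneg hr))
    rw [one_mul, Real.norm_of_nonneg (T_nonneg hr), Real.norm_of_nonneg h0,
      T_eq_proximity_of_differentiable a.differentiable, proximity_top]
    refine circleAverage_mono_on_of_le_circle ?_ fun z hz ↦ ?_
    · exact MeromorphicOn.circleIntegrable_posLog_norm
        fun z _ ↦ (analyticAt_polynomial a z).meromorphicAt
    · have hz' : ‖z‖ = r := by simpa [abs_of_pos (by linarith : 0 < r)] using hz
      have h2 := hC z (by linarith)
      rw [hz'] at h2
      refine (posLog_le_posLog (norm_nonneg _) h2).trans ?_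
      rw [posLog_eq_log, log_mul (by positivity) (by positivity), log_pow]
      rw [abs_of_nonneg (by positivity)]
      exact one_le_mul_of_one_le_of_one_le hC1 (one_le_pow₀ hr)
  refine hb.trans (Asymptotics.IsBigO.add ?_ ?_)
  · exact (Asymptotics.isLittleO_const_left.2
      (Or.inr (tendsto_norm_atTop_atTop.comp tendsto_log_atTop))).isBigO
  · exact (Asymptotics.isBigO_refl _ _).const_mul_left _

lemma T_ratEval_isBigO_log (q : RatFunc ℂ) : T (ratEval q) =O[atTop] log := by
  set a : ℂ → ℂ := fun z ↦ q.num.eval z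
  set b : ℂ → ℂ := fun z ↦ q.denom.eval z
  have ha : Meromorphic a := fun z ↦ (analyticAt_polynomial _ z).meromorphicAt
  have hb : Meromorphic b := fun z ↦ (analyticAt_polynomial _ z).meromorphicAt
  have hq : ratEval q = a * b⁻¹ := funext fun z ↦ by
    simp [ratEval_eq_div, a, b, div_eq_mul_inv]
  have hconst : ∀ c : ℝ, (fun _ : ℝ ↦ c) =O[atTop] log := fun c ↦
    (Asymptotics.isLittleO_const_left.2
      (Or.inr (tendsto_norm_atTop_atTop.comp tendsto_log_atTop))).isBigO
  have h1 : (fun r ↦ T a r + (T b r - log ‖meromorphicTrailingCoeffAt b 0‖)) =O[atTop] log :=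
    (T_polynomial_isBigO_log q.num).add ((T_polynomial_isBigO_log q.denom).sub (hconst _))
  refine Asymptotics.IsBigO.trans (Asymptotics.IsBigO.of_bound 1 ?_) h1
  filter_upwards [eventually_ge_atTop 1] with r hr
  have hab : T (ratEval q) r ≤ T a r + T b⁻¹ r := by
    rw [hq]
    exact T_mul_le hr ha hb.inv
  rw [T_inv hb (by linarith)] at hab
  rw [one_mul, Real.norm_of_nonneg (T_nonneg hr), Real.norm_of_nonneg ((T_nonneg hr).trans hab)]
  exact hab

lemma ratEval_mul_C (q : RatFunc ℂ) (c : ℂ) :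
    ratEval (q * RatFunc.C c) =ᶠ[codiscrete ℂ] fun z ↦ ratEval q z * c := by
  filter_upwards [(finite_denom_eval_eq_zero q).compl_mem_codiscrete] with z hz
  rw [ratEval, RatFunc.eval_mul]
  · simp [ratEval]
  · simpa [Polynomial.eval₂_id] using hz
  · simp

/-! ### Growth of transcendental meromorphic functions -/

theorem exists_eq_prod_zpow_mul_exp {g : ℂ → ℂ} (hg : Meromorphic g)
    (hnt : ∀ z, meromorphicOrderAt g z ≠ ⊤)
    (hfin : (MeromorphicOn.divisor g Set.univ).support.Finite) :
    ∃ G : ℂ → ℂ, Differentiable ℂ G ∧ g =ᶠ[codiscrete ℂ]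
      fun z ↦ (∏ u ∈ hfin.toFinset, (z - u) ^ MeromorphicOn.divisor g Set.univ u)
        * Complex.exp (G z) := by
  set D := MeromorphicOn.divisor g Set.univ
  obtain ⟨e, hea, hene, hge⟩ :=
    (hg.meromorphicOn (s := Set.univ)).extract_zeros_poles (fun u ↦ hnt u) hfin
  obtain ⟨G, hG, heG⟩ := exists_eq_exp_of_differentiable
    (fun z ↦ (hea z (Set.mem_univ z)).differentiableAt) (fun z ↦ hene ⟨z, Set.mem_univ z⟩)
  refine ⟨G, hG, ?_⟩
  have hprod : (∏ᶠ u, (· - u) ^ D u : ℂ → ℂ) = fun z ↦ ∏ u ∈ hfin.toFinset, (z - u) ^ D u := by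
    rw [finprod_eq_prod_of_mulSupport_subset (s := hfin.toFinset)]
    · ext z; simp
    · rw [Function.FactorizedRational.mulSupport]; simp
  filter_upwards [hge] with z hz
  rw [hz, hprod, ← heG]
  rfl

theorem TranscendentalMeromorphic.order_ne_top {f : ℂ → ℂ} (hf : TranscendentalMeromorphic f) (z : ℂ) :
    meromorphicOrderAt f z ≠ ⊤ := by
  refine (eventuallyEq_zero_or_forall_order_ne_top hf.1).resolve_left (fun h ↦ hf.2 ⟨0, ?_⟩) z
  filter_upwards [h] with w hw
  simp [hw, ratEval]

/-- If `N` points of the divisor lie in the disk of radius `√r`, they contribute at least `N log (r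
/ √r) = (N / 2) log r` to the counting functions at `r`. These are at most `T f + T f⁻¹ ≤ 2 c log r
+ κ`, so `N ≤ 4 c + 2 κ` once `log r ≥ 1`. -/
lemma finite_divisor_support_of_frequently {f : ℂ → ℂ} (hf : Meromorphic f) {c : ℝ}
    (hfr : ∃ᶠ r in atTop, T f r ≤ c * log r) :
    (MeromorphicOn.divisor f Set.univ).support.Finite := by
  by_contra hinf
  set κ := |log ‖meromorphicTrailingCoeffAt f 0‖|
  obtain ⟨N, hN⟩ := exists_nat_gt (4 * c + 2 * κ)
  obtain ⟨s, hs, hcard⟩ := Set.Infinite.exists_subset_card_eq hinf N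
  obtain ⟨M, hM⟩ : ∃ M : ℝ, ∀ u ∈ s, ‖u‖ ≤ M := s.finite_toSet.isBounded.exists_norm_le
  obtain ⟨r, hT, hr, hMr⟩ := (hfr.and_eventually
    ((tendsto_log_atTop.eventually_ge_atTop 1).and (eventually_ge_atTop (max 4 (M ^ 2))))).exists
  have hr4 : 4 ≤ r := (le_max_left _ _).trans hMr
  have hsq1 : 1 ≤ √r := one_le_sqrt.2 (by linarith)
  have hsr : √r < r := by
    have h1 : 2 ≤ √r := le_sqrt_of_sq_le (by linarith)
    have h2 : √r * √r = r := mul_self_sqrt (by linarith)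
    nlinarith
  have h1 := sum_abs_divisor_le (g := f) hsq1 hsr s
    (fun u hu ↦ (hM u hu).trans (le_sqrt_of_sq_le ((le_max_right _ _).trans hMr)))
  have hlog : log (r / √r) = log r / 2 := by
    rw [div_sqrt, log_sqrt (by linarith)]
  have h2 : (N : ℝ) ≤ ∑ u ∈ s, |(MeromorphicOn.divisor f Set.univ u : ℝ)| := by
    rw [← hcard, Finset.card_eq_sum_ones, Nat.cast_sum]
    refine Finset.sum_le_sum fun u hu ↦ ?_
    have h0 : MeromorphicOn.divisor f Set.univ u ≠ 0 := hs hu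
    exact_mod_cast Int.one_le_abs h0
  have h3 := proximity_add_proximity_inv_add_logCounting (g := f) r
  have h4 := proximity_nonneg (f := f) (a := ⊤) r
  have h5 := proximity_nonneg (f := f⁻¹) (a := ⊤) r
  have h6 := T_inv hf (by linarith : r ≠ 0)
  have h7 := neg_abs_le (log ‖meromorphicTrailingCoeffAt f 0‖)
  simp only [Pi.zero_apply] at h4 h5
  rw [hlog] at h1
  have h8 : (N : ℝ) * (log r / 2) ≤ 2 * (c * log r) + κ :=
    (mul_le_mul_of_nonneg_right h2 (by linarith)).trans (by linarith)
  have h9 : κ * 1 ≤ κ * log r := mul_le_mul_of_nonneg_left hr (abs_nonneg _)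
  have h10 : (4 * c + 2 * κ) * log r < N * log r := by gcongr
  linarith

/-- Otherwise `T f = O(log r)` along arbitrarily large radii. Then `f` has finitely many zeros and
poles, `f = q e^G`, and the mean of `|Re G|` on these circles is `O(log r)`. The Schwarz estimate
makes `G'` of size `O(log r / r)`, so `G` is constant and `f` rational. -/
theorem TranscendentalMeromorphic.log_isLittleO_T {f : ℂ → ℂ} (hf : TranscendentalMeromorphic f) :
    log =o[atTop] T f := by
  by_contra hnot
  rw [Asymptotics.isLittleO_iff] at hnot
  push Not at hnot
  obtain ⟨c, hc, hfr⟩ := hnot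
  have hfr' : ∃ᶠ r in atTop, T f r ≤ c⁻¹ * log r := by
    refine (hfr.and_eventually (eventually_ge_atTop 1)).mono fun r ⟨h1, h2⟩ ↦ ?_
    rw [Real.norm_of_nonneg (T_nonneg h2), Real.norm_of_nonneg (log_nonneg h2)] at h1
    rw [inv_mul_eq_div, le_div_iff₀' hc]
    exact h1.le
  have hfin := finite_divisor_support_of_frequently hf.1 hfr'
  obtain ⟨G, hG, hfG⟩ := exists_eq_prod_zpow_mul_exp hf.1 hf.order_ne_top hfin
  set D := MeromorphicOn.divisor f Set.univ with hD
  set s := hfin.toFinset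
  set S := ∑ u ∈ s, |(D u : ℝ)|
  set κ := |log ‖meromorphicTrailingCoeffAt f 0‖|
  have hS : 0 ≤ S := Finset.sum_nonneg fun _ _ ↦ abs_nonneg _
  obtain ⟨M, hM⟩ : ∃ M : ℝ, ∀ u ∈ s, ‖u‖ ≤ M := s.finite_toSet.isBounded.exists_norm_le
  have hderiv : ∀ z, deriv G z = 0 := by
    intro z
    by_contra hz
    have hlim : Tendsto (fun r : ℝ ↦ 8 * ((2 * c⁻¹ + 2 * S) * (log r / r) + (κ + 2 * S * log 2) / r))
        atTop (𝓝 0) := by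
      have h1 : Tendsto (fun r : ℝ ↦ log r / r) atTop (𝓝 0) :=
        isLittleO_log_id_atTop.tendsto_div_nhds_zero
      have h2 : Tendsto (fun r : ℝ ↦ (κ + 2 * S * log 2) / r) atTop (𝓝 0) :=
        tendsto_const_nhds.div_atTop tendsto_id
      simpa using ((h1.const_mul (2 * c⁻¹ + 2 * S)).add h2).const_mul 8
    obtain ⟨r, hT, hlt, hr⟩ := (hfr'.and_eventually
      ((hlim.eventually_lt_const (norm_pos_iff.2 hz)).and
        (eventually_ge_atTop (max (max 1 M) (2 * ‖z‖ + 1))))).exists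
    have hr1 : 1 ≤ r := (le_max_left _ _).trans ((le_max_left _ _).trans hr)
    have hrM : M ≤ r := (le_max_right _ _).trans ((le_max_left _ _).trans hr)
    have hrz : 2 * ‖z‖ + 1 ≤ r := (le_max_right _ _).trans hr
    have hz0 := norm_nonneg z
    have h1 := norm_deriv_le_circleAverage_abs_re (G := G) (ρ := r + 1) (R := r) (z := z)
      hG.differentiableOn (by linarith) (by linarith)
    have h2 := circleAverage_abs_log_norm_le hf.1 hr1 le_rfl (fun u hu ↦ (hM u hu).trans hrM) (D := D)
      (e := fun z ↦ Complex.exp (G z)) (hG.continuous.cexp.continuousOn)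
      (fun _ _ ↦ Complex.exp_ne_zero _) (hfG.filter_mono (codiscreteWithin_mono (Set.subset_univ _)))
    simp only [Complex.norm_exp, log_exp] at h2
    have h3 := proximity_add_proximity_inv_add_logCounting (g := f) r
    have h4 := logCounting_nonneg (f := f) (e := 0) hr1
    have h5 := logCounting_nonneg (f := f) (e := ⊤) hr1
    have h6 := T_inv hf.1 (by linarith : r ≠ 0)
    have h7 := neg_abs_le (log ‖meromorphicTrailingCoeffAt f 0‖)
    rw [log_mul (by norm_num) (by linarith)] at h2
    have h8 : circleAverage (fun w ↦ |(G w).re|) 0 r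
        ≤ (2 * c⁻¹ + 2 * S) * log r + (κ + 2 * S * log 2) := by
      change _ ≤ _ + S * _ at h2
      linarith
    have h9 : 2 * r / (r - ‖z‖) ^ 2 ≤ 8 / r := by
      rw [div_le_div_iff₀ (by nlinarith) (by linarith)]
      nlinarith
    have h10 : 0 ≤ (2 * c⁻¹ + 2 * S) * log r + (κ + 2 * S * log 2) := by
      have := log_nonneg hr1
      positivity
    have h11 : ‖deriv G z‖ ≤ 8 / r * ((2 * c⁻¹ + 2 * S) * log r + (κ + 2 * S * log 2)) :=
      h1.trans ((mul_le_mul_of_nonneg_left h8 (by positivity)).trans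
        (mul_le_mul_of_nonneg_right h9 h10))
    have h12 : 8 / r * ((2 * c⁻¹ + 2 * S) * log r + (κ + 2 * S * log 2))
      = 8 * ((2 * c⁻¹ + 2 * S) * (log r / r) + (κ + 2 * S * log 2) / r) := by ring
    linarith
  obtain ⟨q, hq0, hq⟩ := exists_ratEval_eq_prod_zpow s D
  refine hf.2 ⟨q * RatFunc.C (Complex.exp (G 0)), ?_⟩
  filter_upwards [hfG, hq, ratEval_mul_C q (Complex.exp (G 0))] with z h1 h2 h3
  rw [h1, h3, h2, is_const_of_deriv_eq_zero hG hderiv z 0]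

/-! ### Identities off discrete sets, orders of derivatives, sums in the proximity function -/

lemma eventually_codiscrete_iff {p : ℂ → Prop} :
    (∀ᶠ z in codiscrete ℂ, p z) ↔ ∀ x, ∀ᶠ z in 𝓝[≠] x, p z :=
  (mem_codiscreteWithin_iff_forall_mem_nhdsNE (S := {z | p z}) (T := Set.univ)).trans
    (by simp [Filter.Eventually])

lemma eventuallyEq_deriv {g₁ g₂ : ℂ → ℂ} (h : g₁ =ᶠ[codiscrete ℂ] g₂) :
    deriv g₁ =ᶠ[codiscrete ℂ] deriv g₂ :=
  eventually_codiscrete_iff.2 fun x ↦ Filter.EventuallyEq.nhdsNE_deriv (eventually_codiscrete_iff.1 h x)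

lemma eventuallyEq_iteratedDeriv {g₁ g₂ : ℂ → ℂ} (h : g₁ =ᶠ[codiscrete ℂ] g₂) (s : ℕ) :
    iteratedDeriv s g₁ =ᶠ[codiscrete ℂ] iteratedDeriv s g₂ := by
  induction s with
  | zero => simpa using h
  | succ s ih =>
    rw [iteratedDeriv_succ, iteratedDeriv_succ]
    exact eventuallyEq_deriv ih

lemma iteratedDeriv_zero_fun (s : ℕ) : iteratedDeriv s (0 : ℂ → ℂ) = 0 := by
  induction s with
  | zero => simp
  | succ s ih => rw [iteratedDeriv_succ, ih]; ext z; simp [Pi.zero_def]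

lemma eventually_ne_zero {g : ℂ → ℂ} (hg : Meromorphic g) (hnt : ∀ z, meromorphicOrderAt g z ≠ ⊤) :
    ∀ᶠ z in codiscrete ℂ, g z ≠ 0 :=
  eventually_codiscrete_iff.2 fun x ↦ (meromorphicOrderAt_ne_top_iff_eventually_ne_zero (hg x)).1 (hnt x)

lemma meromorphic_iteratedDeriv {g : ℂ → ℂ} (hg : Meromorphic g) (s : ℕ) :
    Meromorphic (iteratedDeriv s g) := by
  rw [iteratedDeriv_eq_iterate]
  exact hg.iterated_deriv

lemma eventually_analyticAt {g : ℂ → ℂ} (hg : Meromorphic g) :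
    ∀ᶠ z in codiscrete ℂ, AnalyticAt ℂ g z :=
  eventually_codiscrete_iff.2 fun x ↦ (hg x).eventually_analyticAt

section Order

variable {g : ℂ → ℂ} {x : ℂ}

lemma meromorphicOrderAt_deriv_eq_top (h : meromorphicOrderAt g x = ⊤) :
    meromorphicOrderAt (deriv g) x = ⊤ := by
  rw [meromorphicOrderAt_eq_top_iff] at h ⊢
  have h' : g =ᶠ[𝓝[≠] x] fun _ ↦ 0 := h
  filter_upwards [h'.nhdsNE_deriv] with z hz
  simp [hz]

lemma meromorphicOrderAt_deriv_nonneg (hg : MeromorphicAt g x) (h : 0 ≤ meromorphicOrderAt g x) :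
    0 ≤ meromorphicOrderAt (deriv g) x := by
  by_cases htop : meromorphicOrderAt g x = ⊤
  · simp [meromorphicOrderAt_deriv_eq_top htop]
  lift meromorphicOrderAt g x to ℤ using htop with m hm
  have hm0 : 0 ≤ m := by exact_mod_cast h
  rcases hm0.eq_or_lt with h0 | h0
  · rw [← h0] at hm
    obtain ⟨e, he, -, hge⟩ := (meromorphicOrderAt_eq_int_iff hg).1 hm.symm
    have h1 : g =ᶠ[𝓝[≠] x] e := by
      filter_upwards [hge] with z hz using by simpa using hz
    rw [meromorphicOrderAt_congr h1.nhdsNE_deriv]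
    exact he.deriv.meromorphicOrderAt_nonneg
  · rw [meromorphicOrderAt_deriv_eq_sub_one (by exact_mod_cast h0.ne') hm.symm]
    exact_mod_cast (by lia : (0 : ℤ) ≤ m - 1)

lemma le_meromorphicOrderAt_deriv (hg : MeromorphicAt g x) {m : ℤ}
    (h : (m : WithTop ℤ) ≤ meromorphicOrderAt g x) :
    ((m - 1 : ℤ) : WithTop ℤ) ≤ meromorphicOrderAt (deriv g) x := by
  by_cases htop : meromorphicOrderAt g x = ⊤
  · simp [meromorphicOrderAt_deriv_eq_top htop]
  by_cases h0 : meromorphicOrderAt g x = 0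
  · have := meromorphicOrderAt_deriv_nonneg hg h0.ge
    rw [h0] at h
    have h1 : m ≤ 0 := by exact_mod_cast h
    refine le_trans ?_ this
    exact_mod_cast (by lia : m - 1 ≤ 0)
  lift meromorphicOrderAt g x to ℤ using htop with k hk
  rw [meromorphicOrderAt_deriv_eq_sub_one (by exact_mod_cast h0) hk.symm]
  have h1 : m ≤ k := by exact_mod_cast h
  exact_mod_cast (by lia : m - 1 ≤ k - 1)

lemma meromorphicOrderAt_iteratedDeriv_nonneg (hg : Meromorphic g)
    (h : 0 ≤ meromorphicOrderAt g x) (s : ℕ) : 0 ≤ meromorphicOrderAt (iteratedDeriv s g) x := by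
  induction s with
  | zero => simpa using h
  | succ s ih =>
    rw [iteratedDeriv_succ]
    exact meromorphicOrderAt_deriv_nonneg (meromorphic_iteratedDeriv hg s x) ih

lemma le_meromorphicOrderAt_iteratedDeriv (hg : Meromorphic g) {m : ℤ}
    (h : (m : WithTop ℤ) ≤ meromorphicOrderAt g x) (s : ℕ) :
    ((m - s : ℤ) : WithTop ℤ) ≤ meromorphicOrderAt (iteratedDeriv s g) x := by
  induction s with
  | zero => simpa using h
  | succ s ih =>
    rw [iteratedDeriv_succ]
    have := le_meromorphicOrderAt_deriv (meromorphic_iteratedDeriv hg s x) ih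
    rwa [sub_sub, ← Nat.cast_succ] at this

/-- Differentiation lowers a non-zero order by exactly one. The condition on `m` keeps the order
from reaching `0` before the last differentiation. -/
lemma meromorphicOrderAt_iteratedDeriv {m : ℤ}
    (h : meromorphicOrderAt g x = m) (s : ℕ) (hs : m < 0 ∨ s ≤ m) :
    meromorphicOrderAt (iteratedDeriv s g) x = ((m - s : ℤ) : WithTop ℤ) := by
  induction s with
  | zero => simpa using h
  | succ s ih =>
    rw [iteratedDeriv_succ]
    have h1 : m < 0 ∨ (s : ℤ) ≤ m := by lia
    have h2 : m - s ≠ 0 := by lia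
    have := meromorphicOrderAt_deriv_eq_sub_one (by exact_mod_cast h2) (ih h1)
    rwa [sub_sub, ← Nat.cast_succ] at this

end Order

lemma divisor_univ_apply {g : ℂ → ℂ} (hg : Meromorphic g) (z : ℂ) :
    MeromorphicOn.divisor g Set.univ z = (meromorphicOrderAt g z).untop₀ :=
  MeromorphicOn.divisor_apply hg.meromorphicOn (Set.mem_univ z)

/-- A pole of order `m ≥ 1` becomes one of order `m + 1 ≤ 2 m`, and no other poles arise. -/
lemma logCounting_deriv_le {g : ℂ → ℂ} (hg : Meromorphic g) {r : ℝ} (hr : 1 ≤ r) :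
    logCounting (deriv g) ⊤ r ≤ 2 * logCounting g ⊤ r := by
  have h : (MeromorphicOn.divisor (deriv g) Set.univ)⁻
      ≤ (MeromorphicOn.divisor g Set.univ)⁻ + (MeromorphicOn.divisor g Set.univ)⁻ := by
    intro z
    simp only [Function.locallyFinsuppWithin.coe_add, Pi.add_apply,
      Function.locallyFinsuppWithin.negPart_apply, divisor_univ_apply hg,
      divisor_univ_apply hg.deriv]
    rcases le_or_gt 0 (meromorphicOrderAt g z) with h0 | h0
    · have h1 := meromorphicOrderAt_deriv_nonneg (hg z) h0
      rw [negPart_eq_zero.2 (WithTop.untop₀_nonneg.2 h1)]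
      exact add_nonneg (negPart_nonneg _) (negPart_nonneg _)
    · lift meromorphicOrderAt g z to ℤ using h0.ne_top with m hm
      have hm0 : m < 0 := by exact_mod_cast h0
      rw [meromorphicOrderAt_deriv_eq_sub_one (by exact_mod_cast hm0.ne) hm.symm]
      simp only [WithTop.untop₀_coe]
      change max (-(m - 1)) 0 ≤ max (-m) 0 + max (-m) 0
      lia
  have := Function.locallyFinsuppWithin.logCounting_le h hr
  rw [map_add, Pi.add_apply, ← logCounting_top, ← logCounting_top] at this
  linarith

lemma proximity_le_sum {ι : Type} [Fintype ι] {w : ι → ℂ → ℂ} {g : ℂ → ℂ}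
    (hg : Meromorphic g) (hw : ∀ i, Meromorphic (w i))
    (h : ∀ᶠ z in codiscrete ℂ, ‖g z‖ ≤ ∑ i, ‖w i z‖) {r : ℝ} (hr : r ≠ 0) :
    proximity g ⊤ r ≤ ∑ i, proximity (w i) ⊤ r + log (Fintype.card ι) := by
  classical
  -- Setting `g` to zero where the inequality fails changes it only on a discrete set, so the
  -- proximity function is the same and the bound becomes pointwise.
  set g' : ℂ → ℂ := fun z ↦ if ‖g z‖ ≤ ∑ i, ‖w i z‖ then g z else 0
  have hgg : g =ᶠ[codiscrete ℂ] g' := by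
    filter_upwards [h] with z hz
    simp [g', hz]
  have hle : ∀ z, ‖g' z‖ ≤ ∑ i, ‖w i z‖ := fun z ↦ by
    simp only [g']
    split_ifs with h
    · exact h
    · rw [norm_zero]
      exact Finset.sum_nonneg fun _ _ ↦ norm_nonneg _
  have hint : ∀ i ∈ Finset.univ, CircleIntegrable (fun z ↦ log⁺ ‖w i z‖) 0 r := fun i _ ↦
    (hw i).meromorphicOn.circleIntegrable_posLog_norm
  have hint' : CircleIntegrable (fun z ↦ log⁺ ‖g' z‖) 0 r := by
    refine CircleIntegrable.congr_codiscreteWithin ?_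
      (hg.meromorphicOn (s := sphere 0 |r|)).circleIntegrable_posLog_norm
    filter_upwards [hgg.filter_mono (codiscreteWithin_mono (Set.subset_univ _))] with z hz
    rw [hz]
  rw [proximity_congr_codiscrete hgg hr, proximity_top]
  simp only [proximity_top]
  rw [← circleAverage_fun_sum hint, ← circleAverage_const (log (Fintype.card ι) : ℝ) 0 r,
    ← circleAverage_fun_add (CircleIntegrable.fun_sum _ hint) (circleIntegrable_const _ _ _)]
  refine circleAverage_mono hint'
    ((CircleIntegrable.fun_sum _ hint).add (circleIntegrable_const _ _ _)) fun z _ ↦ ?_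
  refine (posLog_le_posLog (norm_nonneg _) (hle z)).trans ?_
  have := posLog_sum Finset.univ (fun i ↦ ‖w i z‖)
  rw [Finset.card_univ] at this
  linarith

/-! ### Closure properties of dominated functions and of functions with small proximity -/

/-- `g` is meromorphic and its characteristic is `O(T(r, f))` off a set of finite measure. -/
def Dominated (f g : ℂ → ℂ) : Prop := Meromorphic g ∧ T g =O[exceptional] T f

/-- `w` is meromorphic and its proximity function is `o(T(r, f))` off a set of finite measure. -/
def SmallProximity (f w : ℂ → ℂ) : Prop :=
  Meromorphic w ∧ proximity w ⊤ =o[exceptional] T f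

lemma eventually_exceptional_ge (a : ℝ) : ∀ᶠ r in exceptional, a ≤ r :=
  mem_inf_of_left (Ici_mem_atTop a)

section Closure

variable {f g g₁ g₂ w w₁ w₂ : ℂ → ℂ}

lemma isBigO_T_of_le {u : ℝ → ℝ} (h : ∀ᶠ r in exceptional, T g r ≤ u r)
    (hu : u =O[exceptional] T f) : T g =O[exceptional] T f := by
  refine Asymptotics.IsBigO.trans (Asymptotics.IsBigO.of_bound 1 ?_) hu
  filter_upwards [h, eventually_exceptional_ge 1] with r hr hr1
  rw [one_mul, Real.norm_of_nonneg (T_nonneg hr1), Real.norm_of_nonneg ((T_nonneg hr1).trans hr)]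
  exact hr

lemma isLittleO_proximity_of_le {u : ℝ → ℝ} (h : ∀ᶠ r in exceptional, proximity w ⊤ r ≤ u r)
    (hu : u =o[exceptional] T f) : proximity w ⊤ =o[exceptional] T f := by
  refine Asymptotics.IsBigO.trans_isLittleO (Asymptotics.IsBigO.of_bound 1 ?_) hu
  filter_upwards [h] with r hr
  rw [one_mul, Real.norm_of_nonneg (proximity_nonneg r)]
  exact hr.trans (le_abs_self _)

lemma Dominated.congr (h : Dominated f g₁) (hg : Meromorphic g₂) (he : g₁ =ᶠ[codiscrete ℂ] g₂) :
    Dominated f g₂ := by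
  refine ⟨hg, isBigO_T_of_le ?_ h.2⟩
  filter_upwards [eventually_exceptional_ge 1] with r hr
  exact (T_congr he (by linarith)).ge

lemma Dominated.mul (h₁ : Dominated f g₁) (h₂ : Dominated f g₂) : Dominated f (g₁ * g₂) := by
  refine ⟨h₁.1.mul h₂.1, isBigO_T_of_le ?_ (h₁.2.add h₂.2)⟩
  filter_upwards [eventually_exceptional_ge 1] with r hr
  exact T_mul_le hr h₁.1 h₂.1

lemma Dominated.add (hlog : log =o[atTop] T f) (h₁ : Dominated f g₁) (h₂ : Dominated f g₂) :
    Dominated f (g₁ + g₂) := by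
  refine ⟨h₁.1.add h₂.1, isBigO_T_of_le ?_
    ((h₁.2.add h₂.2).add (isLittleO_const_T hlog (log 2)).isBigO)⟩
  filter_upwards [eventually_exceptional_ge 1] with r hr
  exact T_add_le hr h₁.1 h₂.1

lemma Dominated.inv (hlog : log =o[atTop] T f) (h : Dominated f g) : Dominated f g⁻¹ :=
  ⟨h.1.inv, isBigO_T_inv hlog h.1 h.2⟩

lemma dominated_const (hlog : log =o[atTop] T f) (c : ℂ) : Dominated f fun _ ↦ c := by
  refine ⟨.const c, isBigO_T_of_le (u := fun _ ↦ log⁺ ‖c‖) (Eventually.of_forall fun r ↦ ?_)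
    (isLittleO_const_T hlog _).isBigO⟩
  simp [T, characteristic]

lemma Dominated.pow (hlog : log =o[atTop] T f) (h : Dominated f g) (n : ℕ) :
    Dominated f (g ^ n) := by
  induction n with
  | zero => rw [pow_zero]; exact dominated_const hlog 1
  | succ n ih => rw [pow_succ]; exact ih.mul h

lemma Dominated.prod (hlog : log =o[atTop] T f) {ι : Type} (s : Finset ι) {G : ι → ℂ → ℂ}
    (h : ∀ i, Dominated f (G i)) : Dominated f (∏ i ∈ s, G i) := by
  classical
  induction s using Finset.induction_on with
  | empty => rw [Finset.prod_empty]; exact dominated_const hlog 1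
  | insert i s hi ih => rw [Finset.prod_insert hi]; exact (h i).mul ih

lemma deriv_eventuallyEq_logDeriv_mul (hg : Meromorphic g)
    (hnt : ∀ z, meromorphicOrderAt g z ≠ ⊤) : deriv g =ᶠ[codiscrete ℂ] logDeriv g * g := by
  filter_upwards [eventually_ne_zero hg hnt] with z hz
  simp [logDeriv_apply, hz]

/-- From `g' = (g' / g) · g` one gets `T(g') ≤ m(g' / g) + m(g) + 2 N(g)`, and the first term is
small. -/
lemma Dominated.deriv (hlog : log =o[atTop] T f) (h : Dominated f g) : Dominated f (deriv g) := by
  rcases eventuallyEq_zero_or_forall_order_ne_top h.1 with h0 | hnt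
  · refine (dominated_const hlog 0).congr h.1.deriv (EventuallyEq.symm ?_)
    simpa [Pi.zero_def] using eventuallyEq_deriv h0
  refine ⟨h.1.deriv, isBigO_T_of_le ?_
    ((proximity_logDeriv_isLittleO hlog h.1 hnt h.2).isBigO.add (h.2.const_mul_left 2))⟩
  filter_upwards [eventually_exceptional_ge 1] with r hr
  have h1 := proximity_mul_top_le h.1.logDeriv h.1 r
  rw [← proximity_congr_codiscrete (deriv_eventuallyEq_logDeriv_mul h.1 hnt) (by linarith)] at h1
  have h2 := logCounting_deriv_le h.1 hr
  have h3 := proximity_nonneg (f := g) (a := ⊤) r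
  simp only [T, characteristic, Pi.add_apply, Pi.zero_apply] at *
  linarith

lemma Dominated.iteratedDeriv (hlog : log =o[atTop] T f) (h : Dominated f g) (s : ℕ) :
    Dominated f (iteratedDeriv s g) := by
  induction s with
  | zero => simpa using h
  | succ s ih => rw [iteratedDeriv_succ]; exact ih.deriv hlog

lemma Dominated.smallProximity_logDeriv (hlog : log =o[atTop] T f) (h : Dominated f g) :
    SmallProximity f (logDeriv g) := by
  refine ⟨h.1.logDeriv, ?_⟩
  rcases eventuallyEq_zero_or_forall_order_ne_top h.1 with h0 | hnt
  · refine isLittleO_proximity_of_le (u := 0) ?_ (Asymptotics.isLittleO_zero _ _)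
    filter_upwards [eventually_exceptional_ge 1] with r hr
    have : logDeriv g =ᶠ[codiscrete ℂ] fun _ ↦ 0 := by
      filter_upwards [h0] with z hz
      simp [logDeriv_apply, hz]
    rw [proximity_congr_codiscrete this (by linarith)]
    simp
  · exact proximity_logDeriv_isLittleO hlog h.1 hnt h.2

lemma SmallProximity.congr (h : SmallProximity f w₁) (hw : Meromorphic w₂)
    (he : w₁ =ᶠ[codiscrete ℂ] w₂) : SmallProximity f w₂ := by
  refine ⟨hw, isLittleO_proximity_of_le ?_ h.2⟩
  filter_upwards [eventually_exceptional_ge 1] with r hr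
  exact (proximity_congr_codiscrete he (by linarith)).ge

lemma SmallProximity.mul (h₁ : SmallProximity f w₁) (h₂ : SmallProximity f w₂) :
    SmallProximity f (w₁ * w₂) :=
  ⟨h₁.1.mul h₂.1, isLittleO_proximity_of_le
    (Eventually.of_forall (proximity_mul_top_le h₁.1 h₂.1)) (h₁.2.add h₂.2)⟩

lemma smallProximity_const (hlog : log =o[atTop] T f) (c : ℂ) : SmallProximity f fun _ ↦ c :=
  ⟨.const c, isLittleO_proximity_of_le (u := fun _ ↦ log⁺ ‖c‖) (by simp) (isLittleO_const_T hlog _)⟩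

lemma SmallProximity.pow (hlog : log =o[atTop] T f) (h : SmallProximity f w) (n : ℕ) :
    SmallProximity f (w ^ n) := by
  induction n with
  | zero => rw [pow_zero]; exact smallProximity_const hlog 1
  | succ n ih => rw [pow_succ]; exact ih.mul h

lemma SmallProximity.prod (hlog : log =o[atTop] T f) {ι : Type} (s : Finset ι) {W : ι → ℂ → ℂ}
    (h : ∀ i, SmallProximity f (W i)) : SmallProximity f (∏ i ∈ s, W i) := by
  classical
  induction s using Finset.induction_on with
  | empty => rw [Finset.prod_empty]; exact smallProximity_const hlog 1
  | insert i s hi ih => rw [Finset.prod_insert hi]; exact (h i).mul ih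

lemma SmallProximity.of_norm_le (hlog : log =o[atTop] T f) {ι : Type} [Fintype ι] {W : ι → ℂ → ℂ}
    (h : ∀ i, SmallProximity f (W i)) (hw : Meromorphic w)
    (hle : ∀ᶠ z in codiscrete ℂ, ‖w z‖ ≤ ∑ i, ‖W i z‖) : SmallProximity f w := by
  refine ⟨hw, isLittleO_proximity_of_le ?_
    ((Asymptotics.IsLittleO.fun_sum fun i (_ : i ∈ Finset.univ) ↦ (h i).2).add
      (isLittleO_const_T hlog (log (Fintype.card ι))))⟩
  filter_upwards [eventually_exceptional_ge 1] with r hr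
  exact proximity_le_sum hw (fun i ↦ (h i).1) hle (by linarith)

lemma SmallProximity.sum (hlog : log =o[atTop] T f) {ι : Type} [Fintype ι] {W : ι → ℂ → ℂ}
    (h : ∀ i, SmallProximity f (W i)) : SmallProximity f (∑ i, W i) := by
  refine SmallProximity.of_norm_le hlog h (Meromorphic.sum fun i _ ↦ (h i).1)
    (Eventually.of_forall fun z ↦ ?_)
  rw [Finset.sum_apply]
  exact norm_sum_le _ _

lemma SmallProximity.add (hlog : log =o[atTop] T f) (h₁ : SmallProximity f w₁)
    (h₂ : SmallProximity f w₂) : SmallProximity f (w₁ + w₂) := by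
  have := SmallProximity.sum hlog (W := ![w₁, w₂]) (fun i ↦ by fin_cases i <;> assumption)
  simpa using this

/-- The quotient telescopes into logarithmic derivatives of the successive derivatives `g^{(i)}`,
each of which is again dominated by `f`. -/
theorem Dominated.smallProximity_iteratedDeriv_div (hlog : log =o[atTop] T f) (h : Dominated f g)
    (s : ℕ) : SmallProximity f (_root_.iteratedDeriv s g / g) := by
  induction s with
  | zero =>
    rcases eventuallyEq_zero_or_forall_order_ne_top h.1 with h0 | hnt
    · refine (smallProximity_const hlog 0).congr ((meromorphic_iteratedDeriv h.1 0).div h.1) ?_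
      filter_upwards [h0] with z hz
      simp [hz]
    · refine (smallProximity_const hlog 1).congr ((meromorphic_iteratedDeriv h.1 0).div h.1) ?_
      filter_upwards [eventually_ne_zero h.1 hnt] with z hz
      simp [hz]
  | succ s ih =>
    have hd := h.iteratedDeriv hlog s
    refine ((hd.smallProximity_logDeriv hlog).mul ih).congr
      ((meromorphic_iteratedDeriv h.1 _).div h.1) ?_
    rw [iteratedDeriv_succ]
    rcases eventuallyEq_zero_or_forall_order_ne_top hd.1 with h0 | hnt
    · filter_upwards [h0, eventuallyEq_deriv h0] with z hz hz'
      simp [hz, hz', Pi.zero_def]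
    · filter_upwards [eventually_ne_zero hd.1 hnt] with z hz
      simp only [Pi.mul_apply, Pi.div_apply, logDeriv_apply]
      field_simp

lemma T_ratEval_isLittleO (hlog : log =o[atTop] T f) (q : RatFunc ℂ) :
    T (ratEval q) =o[exceptional] T f :=
  ((T_ratEval_isBigO_log q).trans_isLittleO hlog).mono inf_le_left

lemma dominated_ratEval (hlog : log =o[atTop] T f) (q : RatFunc ℂ) : Dominated f (ratEval q) :=
  ⟨meromorphic_ratEval q, (T_ratEval_isLittleO hlog q).isBigO⟩

lemma smallProximity_of_T_isLittleO (hw : Meromorphic w) (h : T w =o[exceptional] T f) :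
    SmallProximity f w := by
  refine ⟨hw, isLittleO_proximity_of_le ?_ h⟩
  filter_upwards [eventually_exceptional_ge 1] with r hr
  exact le_add_of_nonneg_right (logCounting_nonneg hr)

end Closure

/-! ### The linear operator and the poles of `L(g) / g` -/

/-- The linear differential operator `g ↦ g^{(p)} + ∑_{s < p} r_s g^{(s)}`. -/
noncomputable def linOp (p : ℕ) (r : ℕ → RatFunc ℂ) (g : ℂ → ℂ) : ℂ → ℂ :=
  iteratedDeriv p g + ∑ s ∈ Finset.range p, ratEval (r s) * iteratedDeriv s g

section LinOp

variable {p : ℕ} {r : ℕ → RatFunc ℂ} {g : ℂ → ℂ}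

lemma linOp_apply (z : ℂ) : linOp p r g z
    = iteratedDeriv p g z + ∑ s ∈ Finset.range p, ratEval (r s) z * iteratedDeriv s g z := by
  simp [linOp]

lemma meromorphic_linOp (hg : Meromorphic g) : Meromorphic (linOp p r g) :=
  (meromorphic_iteratedDeriv hg p).add
    (Meromorphic.sum fun s _ ↦ (meromorphic_ratEval _).mul (meromorphic_iteratedDeriv hg s))

lemma linOp_congr {g₁ g₂ : ℂ → ℂ} (h : g₁ =ᶠ[codiscrete ℂ] g₂) :
    linOp p r g₁ =ᶠ[codiscrete ℂ] linOp p r g₂ := by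
  have h1 : ∀ᶠ z in codiscrete ℂ, ∀ s ∈ Finset.range (p + 1),
      iteratedDeriv s g₁ z = iteratedDeriv s g₂ z :=
    (Finset.eventually_all _).2 fun s _ ↦ eventuallyEq_iteratedDeriv h s
  filter_upwards [h1] with z hz
  rw [linOp_apply, linOp_apply, hz p (by simp)]
  congr 1
  refine Finset.sum_congr rfl fun s hs ↦ ?_
  rw [hz s (by simp only [Finset.mem_range] at hs ⊢; lia)]

lemma linOp_zero : linOp p r 0 = 0 := by
  simp [linOp, iteratedDeriv_zero_fun]

lemma linOp_add {g₁ g₂ : ℂ → ℂ} (h₁ : Meromorphic g₁) (h₂ : Meromorphic g₂) :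
    linOp p r (g₁ + g₂) =ᶠ[codiscrete ℂ] linOp p r g₁ + linOp p r g₂ := by
  filter_upwards [eventually_analyticAt h₁, eventually_analyticAt h₂] with z h1 h2
  simp only [Pi.add_apply, linOp_apply, iteratedDeriv_add h1.contDiffAt h2.contDiffAt, mul_add,
    Finset.sum_add_distrib]
  ring

lemma linOp_sum {ι : Type} (t : Finset ι) {G : ι → ℂ → ℂ} (h : ∀ i, Meromorphic (G i)) :
    linOp p r (∑ i ∈ t, G i) =ᶠ[codiscrete ℂ] ∑ i ∈ t, linOp p r (G i) := by
  classical
  induction t using Finset.induction_on with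
  | empty => simp [linOp_zero]
  | insert i t hi ih =>
    rw [Finset.sum_insert hi, Finset.sum_insert hi]
    exact (linOp_add (h i) (Meromorphic.sum fun i _ ↦ h i)).trans (EventuallyEq.rfl.add ih)

theorem smallProximity_linOp_div {f : ℂ → ℂ} (hlog : log =o[atTop] T f) (h : Dominated f g) :
    SmallProximity f (linOp p r g / g) := by
  have h1 : SmallProximity f (∑ s : Fin p, ratEval (r s) * (iteratedDeriv s g / g)) :=
    SmallProximity.sum hlog fun s ↦ (smallProximity_of_T_isLittleO (meromorphic_ratEval _)
      (T_ratEval_isLittleO hlog _)).mul (h.smallProximity_iteratedDeriv_div hlog s)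
  convert (h.smallProximity_iteratedDeriv_div hlog p).add hlog h1 using 1
  ext z
  simp only [Pi.div_apply, linOp_apply, Pi.add_apply, Finset.sum_apply, Pi.mul_apply, add_div,
    Finset.sum_div, mul_div_assoc]
  rw [Finset.sum_range fun s ↦ ratEval (r s) z * (iteratedDeriv s g z / g z)]

lemma le_meromorphicOrderAt_add {g₁ g₂ : ℂ → ℂ} {x : ℂ} {c : WithTop ℤ} (h₁ : MeromorphicAt g₁ x)
    (h₂ : MeromorphicAt g₂ x) (hc₁ : c ≤ meromorphicOrderAt g₁ x)
    (hc₂ : c ≤ meromorphicOrderAt g₂ x) : c ≤ meromorphicOrderAt (g₁ + g₂) x :=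
  (le_min hc₁ hc₂).trans (meromorphicOrderAt_add h₁ h₂)

lemma le_meromorphicOrderAt_sum {ι : Type} (t : Finset ι) {G : ι → ℂ → ℂ} {x : ℂ} {c : WithTop ℤ}
    (h : ∀ i, Meromorphic (G i)) (hc : ∀ i ∈ t, c ≤ meromorphicOrderAt (G i) x) :
    c ≤ meromorphicOrderAt (∑ i ∈ t, G i) x := by
  classical
  induction t using Finset.induction_on with
  | empty =>
    have : meromorphicOrderAt (0 : ℂ → ℂ) x = ⊤ := meromorphicOrderAt_eq_top_iff.2 (by simp)
    rw [Finset.sum_empty, this]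
    exact le_top
  | insert i t hi ih =>
    rw [Finset.sum_insert hi]
    exact le_meromorphicOrderAt_add (h i x) (Meromorphic.sum (fun i _ ↦ h i) x)
      (hc i (by simp)) (ih fun j hj ↦ hc j (by simp [hj]))

lemma neg_negPart_untop₀_le (a : WithTop ℤ) : ((-(a.untop₀)⁻ : ℤ) : WithTop ℤ) ≤ a := by
  cases a with
  | top => simp
  | coe m =>
    rw [WithTop.untop₀_coe]
    exact_mod_cast (neg_le.1 (neg_le_negPart m))

/-- Where `g` has order `m ≠ 0`, each `g^{(s)}` with `s ≤ p` has order at least `m - p`; where `m =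
0`, no order is lost. The loss is thus at most `p` whatever the multiplicity, which is the source of
the reduced counting functions and of the factor `p`. -/
theorem negPart_divisor_linOp_div_le (hg : Meromorphic g) (hnt : ∀ z, meromorphicOrderAt g z ≠ ⊤)
    (z : ℂ) : (MeromorphicOn.divisor (linOp p r g / g) Set.univ z)⁻
      ≤ p * (if MeromorphicOn.divisor g Set.univ z = 0 then 0 else 1)
        + ∑ s ∈ Finset.range p, (MeromorphicOn.divisor (ratEval (r s)) Set.univ z)⁻ := by
  rw [divisor_univ_apply ((meromorphic_linOp hg).div hg), divisor_univ_apply hg]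
  simp only [divisor_univ_apply (meromorphic_ratEval _)]
  set A := ∑ s ∈ Finset.range p, ((meromorphicOrderAt (ratEval (r s)) z).untop₀)⁻ with hA
  have hA0 : 0 ≤ A := Finset.sum_nonneg fun _ _ ↦ negPart_nonneg _
  have hAs : ∀ s ∈ Finset.range p, ((-A : ℤ) : WithTop ℤ) ≤ meromorphicOrderAt (ratEval (r s)) z := by
    intro s hs
    refine le_trans ?_ (neg_negPart_untop₀_le _)
    have := Finset.single_le_sum
      (f := fun s ↦ ((meromorphicOrderAt (ratEval (r s)) z).untop₀)⁻)
      (fun _ _ ↦ negPart_nonneg _) hs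
    exact_mod_cast neg_le_neg this
  obtain ⟨m, hm⟩ := WithTop.ne_top_iff_exists.1 (hnt z)
  rw [← hm, WithTop.untop₀_coe]
  set e : ℤ := p * (if m = 0 then 0 else 1) with he
  have he0 : 0 ≤ e := by rw [he]; split_ifs <;> simp
  have hD : ∀ s ≤ p, ((m - e : ℤ) : WithTop ℤ) ≤ meromorphicOrderAt (iteratedDeriv s g) z := by
    intro s hs
    by_cases h0 : m = 0
    · have := meromorphicOrderAt_iteratedDeriv_nonneg hg (x := z) (by rw [← hm, h0]; simp) s
      simpa [he, h0] using this
    · refine le_trans ?_ (le_meromorphicOrderAt_iteratedDeriv hg hm.le s)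
      have : e = p := by simp [he, h0]
      exact_mod_cast (by lia : m - e ≤ m - s)
  have hL : ((m - e - A : ℤ) : WithTop ℤ) ≤ meromorphicOrderAt (linOp p r g) z := by
    refine le_meromorphicOrderAt_add (meromorphic_iteratedDeriv hg p z)
      (Meromorphic.sum (fun s _ ↦ (meromorphic_ratEval _).mul (meromorphic_iteratedDeriv hg s)) z)
      (le_trans ?_ (hD p le_rfl)) (le_meromorphicOrderAt_sum _
        (fun s ↦ (meromorphic_ratEval _).mul (meromorphic_iteratedDeriv hg s)) fun s hs ↦ ?_)
    · exact_mod_cast (by lia : m - e - A ≤ m - e)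
    · rw [meromorphicOrderAt_mul (meromorphic_ratEval _ z) (meromorphic_iteratedDeriv hg s z)]
      refine le_trans ?_ (add_le_add (hAs s hs) (hD s (Finset.mem_range.1 hs).le))
      exact_mod_cast (by lia : m - e - A ≤ -A + (m - e))
  have hdiv : meromorphicOrderAt (linOp p r g / g) z = meromorphicOrderAt (linOp p r g) z - m := by
    rw [meromorphicOrderAt_div (meromorphic_linOp hg z) (hg z), hm]
  rw [hdiv]
  generalize meromorphicOrderAt (linOp p r g) z = k at hL
  cases k with
  | top =>
    have h0 : ((⊤ : WithTop ℤ) - (m : WithTop ℤ)) = ⊤ := by rfl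
    rw [h0, WithTop.untop₀_top, negPart_zero]
    exact add_nonneg he0 hA0
  | coe k =>
    have hk : m - e - A ≤ k := by exact_mod_cast hL
    have h0 : ((k : WithTop ℤ) - (m : WithTop ℤ)).untop₀ = k - m := by
      rw [← WithTop.LinearOrderedAddCommGroup.coe_sub, WithTop.untop₀_coe]
    rw [h0]
    change max (-(k - m)) 0 ≤ e + A
    lia

end LinOp

/-! ### Reduced counting functions, and zeros and poles when `L(f^n) = 0` -/

section Counting

variable {p n : ℕ} {r : ℕ → RatFunc ℂ} {f : ℂ → ℂ}

lemma reducedLogCounting_top : reducedLogCounting f ⊤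
    = (reduced (MeromorphicOn.divisor f Set.univ)⁻).logCounting := by
  simp [reducedLogCounting]

lemma reducedLogCounting_zero : reducedLogCounting f 0
    = (reduced (MeromorphicOn.divisor f Set.univ)⁺).logCounting := by
  simp [reducedLogCounting]

lemma reduced_apply (D : Function.locallyFinsupp ℂ ℤ) (z : ℂ) :
    reduced D z = if D z = 0 then 0 else 1 := rfl

lemma reduced_le {D : Function.locallyFinsupp ℂ ℤ} (hD : 0 ≤ D) : reduced D ≤ D := by
  intro z
  have : 0 ≤ D z := hD z
  rw [reduced_apply]
  split_ifs with h
  · exact this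
  · lia

lemma reducedLogCounting_zero_le {R : ℝ} (hR : 1 ≤ R) :
    reducedLogCounting f 0 R ≤ logCounting f 0 R := by
  rw [reducedLogCounting_zero, logCounting_zero]
  exact Function.locallyFinsuppWithin.logCounting_le (reduced_le (posPart_nonneg _)) hR

lemma reducedLogCounting_top_le {R : ℝ} (hR : 1 ≤ R) :
    reducedLogCounting f ⊤ R ≤ logCounting f ⊤ R := by
  rw [reducedLogCounting_top, logCounting_top]
  exact Function.locallyFinsuppWithin.logCounting_le (reduced_le (negPart_nonneg _)) hR

lemma reduced_posPart_add_reduced_negPart (D : Function.locallyFinsupp ℂ ℤ) (z : ℂ) :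
    reduced D⁺ z + reduced D⁻ z = if D z = 0 then 0 else 1 := by
  rw [reduced_apply, reduced_apply, Function.locallyFinsuppWithin.posPart_apply,
    Function.locallyFinsuppWithin.negPart_apply]
  change (if max (D z) 0 = 0 then 0 else 1) + (if max (-D z) 0 = 0 then 0 else 1) = _
  split_ifs <;> lia

lemma meromorphic_pow (hf : Meromorphic f) (n : ℕ) : Meromorphic (f ^ n) := fun z ↦ (hf z).pow n

lemma order_pow_ne_top (hf : Meromorphic f) (hnt : ∀ z, meromorphicOrderAt f z ≠ ⊤) (n : ℕ) (z : ℂ) :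
    meromorphicOrderAt (f ^ n) z ≠ ⊤ := by
  obtain ⟨m, hm⟩ := WithTop.ne_top_iff_exists.1 (hnt z)
  rw [meromorphicOrderAt_pow (hf z), ← hm]
  norm_cast
  exact WithTop.coe_ne_top

theorem logCounting_linOp_div_pow_le (hf : Meromorphic f) (hnt : ∀ z, meromorphicOrderAt f z ≠ ⊤)
    (hn : n ≠ 0) {R : ℝ} (hR : 1 ≤ R) :
    logCounting (linOp p r (f ^ n) / f ^ n) ⊤ R
      ≤ p * (reducedLogCounting f 0 R + reducedLogCounting f ⊤ R)
        + ∑ s ∈ Finset.range p, logCounting (ratEval (r s)) ⊤ R := by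
  set D := MeromorphicOn.divisor f Set.univ with hD
  have hle : (MeromorphicOn.divisor (linOp p r (f ^ n) / f ^ n) Set.univ)⁻
      ≤ p • (reduced D⁺ + reduced D⁻)
        + ∑ s ∈ Finset.range p, (MeromorphicOn.divisor (ratEval (r s)) Set.univ)⁻ := by
    intro z
    have h := negPart_divisor_linOp_div_le (p := p) (r := r) (meromorphic_pow hf n) (order_pow_ne_top hf hnt n) z
    rw [MeromorphicOn.divisor_pow hf.meromorphicOn] at h
    have h0 : ((n • D) z = 0) ↔ D z = 0 := by simp [hn]
    simp only [← hD, h0] at h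
    rw [← reduced_posPart_add_reduced_negPart] at h
    rw [Function.locallyFinsuppWithin.negPart_apply]
    refine h.trans (le_of_eq ?_)
    simp [Function.locallyFinsuppWithin.coe_sum, Function.locallyFinsuppWithin.negPart_apply, mul_add]
  have h := Function.locallyFinsuppWithin.logCounting_le hle hR
  rw [map_add, map_nsmul, map_add, map_sum, ← logCounting_top] at h
  simp only [Pi.add_apply, Finset.sum_apply, nsmul_eq_mul, Pi.mul_apply, Pi.natCast_apply] at h
  rw [reducedLogCounting_zero, reducedLogCounting_top]
  simpa only [logCounting_top] using h

/-- At a zero or pole of `f`, of order `μ`, where the coefficients are regular, `n μ` is negative or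
at least `p`, because `p ≤ n`. So the leading derivative of `f^n` has order exactly `n μ - p`,
strictly below the other terms, and nothing can cancel it. -/
theorem finite_divisor_support_of_linOp_pow_eq_zero (hf : Meromorphic f)
    (hnt : ∀ z, meromorphicOrderAt f z ≠ ⊤) (hn : n ≠ 0) (hpn : p ≤ n)
    (h : linOp p r (f ^ n) =ᶠ[codiscrete ℂ] 0) :
    (MeromorphicOn.divisor f Set.univ).support.Finite := by
  refine ((Finset.range p).finite_toSet.biUnion fun s _ ↦
    finite_denom_eval_eq_zero (r s)).subset fun z hz ↦ ?_
  by_contra hzs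
  simp only [Set.mem_iUnion, not_exists, Finset.mem_coe, Set.mem_ofPred_eq] at hzs
  rw [Function.mem_support, divisor_univ_apply hf] at hz
  obtain ⟨μ, hμ⟩ := WithTop.ne_top_iff_exists.1 (hnt z)
  rw [← hμ, WithTop.untop₀_coe] at hz
  have hg : meromorphicOrderAt (f ^ n) z = ((n * μ : ℤ) : WithTop ℤ) := by
    rw [meromorphicOrderAt_pow (hf z), ← hμ]
    norm_cast
  have hm : (n * μ : ℤ) < 0 ∨ (p : ℤ) ≤ n * μ := by
    have hn0 : (0 : ℤ) < n := by exact_mod_cast Nat.pos_of_ne_zero hn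
    have hpn' : (p : ℤ) ≤ n := by exact_mod_cast hpn
    rcases lt_or_gt_of_ne hz with h0 | h0
    · exact Or.inl (mul_neg_of_pos_of_neg hn0 h0)
    · exact Or.inr (by nlinarith)
  have hlead := meromorphicOrderAt_iteratedDeriv hg p hm
  have hmer := fun s ↦ (meromorphic_ratEval (r s)).mul (meromorphic_iteratedDeriv (meromorphic_pow hf n) s)
  have hrest : ((n * μ - p + 1 : ℤ) : WithTop ℤ) ≤ meromorphicOrderAt
      (∑ s ∈ Finset.range p, ratEval (r s) * iteratedDeriv s (f ^ n)) z := by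
    refine le_meromorphicOrderAt_sum _ hmer fun s hs ↦ ?_
    rw [meromorphicOrderAt_mul (meromorphic_ratEval _ z) (meromorphic_iteratedDeriv (meromorphic_pow hf n) s z)]
    have h1 := (analyticAt_ratEval (hzs s hs)).meromorphicOrderAt_nonneg
    have h2 := le_meromorphicOrderAt_iteratedDeriv (meromorphic_pow hf n) hg.ge s
    refine le_trans ?_ (add_le_add h1 h2)
    have hs' : s < p := Finset.mem_range.1 hs
    rw [zero_add]
    exact_mod_cast (by lia : (n * μ - p + 1 : ℤ) ≤ n * μ - s)
  have hord : meromorphicOrderAt (linOp p r (f ^ n)) z = ((n * μ - p : ℤ) : WithTop ℤ) := by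
    rw [← hlead]
    refine meromorphicOrderAt_add_eq_left_of_lt (Meromorphic.sum (fun s _ ↦ hmer s) z) ?_
    rw [hlead]
    refine lt_of_lt_of_le ?_ hrest
    exact_mod_cast (by lia : (n * μ - p : ℤ) < n * μ - p + 1)
  have htop : meromorphicOrderAt (linOp p r (f ^ n)) z = ⊤ :=
    meromorphicOrderAt_eq_top_iff.2 (eventually_codiscrete_iff.1 h z)
  rw [htop] at hord
  exact WithTop.top_ne_coe hord

end Counting

/-! ### The degenerate case: `L(f^n) = 0` forces `f = q e^α` -/

/-- Cauchy's bound for roots, with the powers of `x` replaced by partial products of the `x + w i`.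
If `x` is large, all factors exceed `1 + ∑ ‖r s‖` in norm, the products grow, and the last one
outweighs the rest. -/
lemma norm_le_of_prod_add_sum_eq_zero {p : ℕ} (hp : 1 ≤ p) (x : ℂ) (w r : ℕ → ℂ)
    (h : ∏ i ∈ Finset.range p, (x + w i)
      + ∑ s ∈ Finset.range p, r s * ∏ i ∈ Finset.range s, (x + w i) = 0) :
    ‖x‖ ≤ 1 + (∑ i ∈ Finset.range p, ‖w i‖ + ∑ s ∈ Finset.range p, ‖r s‖) := by
  by_contra! hx
  set M := ∑ s ∈ Finset.range p, ‖r s‖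
  have hM : 0 ≤ M := Finset.sum_nonneg fun _ _ ↦ norm_nonneg _
  obtain ⟨k, rfl⟩ : ∃ k, p = k + 1 := ⟨p - 1, by lia⟩
  set Q : ℕ → ℂ := fun s ↦ ∏ i ∈ Finset.range s, (x + w i) with hQ
  have hbig : ∀ i ∈ Finset.range (k + 1), 1 + M < ‖x + w i‖ := fun i hi ↦ by
    have h1 := Finset.single_le_sum (f := fun i ↦ ‖w i‖) (fun _ _ ↦ norm_nonneg _) hi
    have h2 : ‖x‖ - ‖w i‖ ≤ ‖x + w i‖ := norm_sub_le_norm_add x (w i)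
    linarith
  have hsucc : ∀ s, Q (s + 1) = Q s * (x + w s) := fun s ↦ Finset.prod_range_succ _ _
  have hmono' : ∀ t s, s + t ≤ k → ‖Q s‖ ≤ ‖Q (s + t)‖ := by
    intro t
    induction t with
    | zero => exact fun s _ ↦ le_rfl
    | succ t ih =>
      intro s hs
      have h1 := hbig (s + t) (by simp only [Finset.mem_range]; lia)
      rw [← add_assoc, hsucc, norm_mul]
      exact (ih s (by lia)).trans (le_mul_of_one_le_right (norm_nonneg _) (by linarith))
  have hmono : ∀ s ∈ Finset.range (k + 1), ‖Q s‖ ≤ ‖Q k‖ := fun s hs ↦ by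
    have hs' : s ≤ k := Finset.mem_range_succ_iff.1 hs
    have := hmono' (k - s) s (by lia)
    rwa [Nat.add_sub_cancel' hs'] at this
  have hpos : 0 < ‖Q k‖ := by
    have := hmono 0 (by simp)
    simp only [hQ, Finset.range_zero, Finset.prod_empty, norm_one] at this
    exact zero_lt_one.trans_le this
  have hle : ‖Q (k + 1)‖ ≤ M * ‖Q k‖ := by
    rw [show Q (k + 1) = -_ from eq_neg_of_add_eq_zero_left h, norm_neg, Finset.sum_mul]
    refine (norm_sum_le _ _).trans (Finset.sum_le_sum fun s hs ↦ ?_)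
    rw [norm_mul]
    exact mul_le_mul_of_nonneg_left (hmono s hs) (norm_nonneg _)
  rw [hsucc, norm_mul, mul_comm] at hle
  have h1 := le_of_mul_le_mul_right hle hpos
  have h2 := hbig k (by simp)
  linarith

/-- At a root of the denominator the numerator would vanish too, since `u` is entire; this
contradicts coprimality. A denominator without roots is constant. -/
lemma ratEval_eq_polynomial {u : ℂ → ℂ} (hu : Differentiable ℂ u) {q : RatFunc ℂ}
    (h : u =ᶠ[codiscrete ℂ] ratEval q) : ∃ a : Polynomial ℂ, ∀ z, u z = a.eval z := by
  have heq : (fun z ↦ q.denom.eval z * u z) = fun z ↦ q.num.eval z := by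
    refine AnalyticOnNhd.eq_of_frequently_eq (z₀ := 0)
      (fun z _ ↦ (analyticAt_polynomial _ z).mul (hu.analyticAt z))
      (fun z _ ↦ analyticAt_polynomial _ z) (Eventually.frequently ?_)
    filter_upwards [eventually_codiscrete_iff.1 h 0, eventually_codiscrete_iff.1
      (finite_denom_eval_eq_zero q).compl_mem_codiscrete 0] with z hz hz'
    have h0 : q.denom.eval z ≠ 0 := hz'
    rw [hz, ratEval_eq_div]
    field_simp
  have hroot : ∀ z, q.denom.eval z ≠ 0 := by
    intro z hz
    have h1 := congrFun heq z
    simp only [hz, zero_mul] at h1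
    obtain ⟨a, b, hab⟩ := RatFunc.isCoprime_num_denom q
    have h2 := congrArg (Polynomial.eval z) hab
    simp [hz, ← h1] at h2
  have hdeg : q.denom.degree = 0 := by
    by_contra hd
    obtain ⟨z, hz⟩ := IsAlgClosed.exists_root q.denom hd
    exact hroot z hz
  have hone : q.denom = 1 := (RatFunc.monic_denom q).natDegree_eq_zero.1
    (Polynomial.natDegree_eq_of_degree_eq_some hdeg)
  refine ⟨q.num, fun z ↦ ?_⟩
  have h1 := congrFun heq z
  simpa [hone] using h1

lemma exists_polynomial_derivative_eq (a : Polynomial ℂ) :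
    ∃ b : Polynomial ℂ, Polynomial.derivative b = a := by
  refine ⟨∑ i ∈ Finset.range (a.natDegree + 1),
    Polynomial.C (a.coeff i / (i + 1)) * Polynomial.X ^ (i + 1), ?_⟩
  conv_rhs => rw [a.as_sum_range_C_mul_X_pow]
  rw [Polynomial.derivative_sum]
  refine Finset.sum_congr rfl fun i _ ↦ ?_
  have : (i : ℂ) + 1 ≠ 0 := by exact_mod_cast Nat.succ_ne_zero i
  rw [Polynomial.derivative_C_mul_X_pow]
  push_cast
  rw [div_mul_cancel₀ _ this]

lemma exists_polynomial_of_deriv {G : ℂ → ℂ} (hG : Differentiable ℂ G) {a : Polynomial ℂ}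
    (h : ∀ z, deriv G z = a.eval z) : ∃ b : Polynomial ℂ, ∀ z, G z = b.eval z := by
  obtain ⟨b, hb⟩ := exists_polynomial_derivative_eq a
  refine ⟨b + Polynomial.C (G 0 - b.eval 0), fun z ↦ ?_⟩
  have hd : Differentiable ℂ fun z ↦ G z - b.eval z := hG.sub b.differentiable
  have := is_const_of_deriv_eq_zero hd (fun w ↦ by
    rw [deriv_fun_sub (hG w) b.differentiableAt, h, Polynomial.deriv, hb, sub_self]) z 0
  simp only [Polynomial.eval_add, Polynomial.eval_C]
  linear_combination this

section LogDerivQuotients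

variable {g u : ℂ → ℂ}

lemma iteratedDeriv_succ_div_eventuallyEq (hg : Meromorphic g)
    (hnt : ∀ z, meromorphicOrderAt g z ≠ ⊤) (s : ℕ) :
    iteratedDeriv (s + 1) g / g =ᶠ[codiscrete ℂ]
      deriv (iteratedDeriv s g / g) + logDeriv g * (iteratedDeriv s g / g) := by
  filter_upwards [eventually_ne_zero hg hnt, eventually_analyticAt hg] with z hz ha
  have h1 : DifferentiableAt ℂ (iteratedDeriv s g) z := by
    rw [iteratedDeriv_eq_iterate]
    exact (ha.iterated_deriv s).differentiableAt
  simp only [Pi.add_apply, Pi.mul_apply, Pi.div_apply, deriv_div h1 ha.differentiableAt hz,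
    logDeriv_apply, iteratedDeriv_succ]
  field_simp
  ring

lemma iteratedDeriv_succ_div_eventuallyEq_mul (hg : Meromorphic g)
    (hnt : ∀ z, meromorphicOrderAt g z ≠ ⊤) (s : ℕ) :
    iteratedDeriv (s + 1) g / g =ᶠ[codiscrete ℂ]
      (iteratedDeriv s g / g) * (logDeriv g + logDeriv (iteratedDeriv s g / g)) := by
  refine (iteratedDeriv_succ_div_eventuallyEq hg hnt s).trans ?_
  have hm : Meromorphic (iteratedDeriv s g / g) := (meromorphic_iteratedDeriv hg s).div hg
  rcases eventuallyEq_zero_or_forall_order_ne_top hm with h0 | h0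
  · filter_upwards [h0, eventuallyEq_deriv h0] with z h1 h2
    simp only [Pi.add_apply, Pi.mul_apply, h1, h2]
    simp [Pi.zero_def]
  · filter_upwards [eventually_ne_zero hm h0] with z hz
    simp only [Pi.add_apply, Pi.mul_apply, logDeriv_apply]
    field_simp
    ring

/-- With `y_s = g^{(s)} / g` and `v = g' / g` one has `y_{s+1} = y_s (v + y_s' / y_s)`. This turns a
linear equation for `g` into one of degree `p` in `v`, up to perturbations that are logarithmic
derivatives. -/
lemma iteratedDeriv_div_eventuallyEq_prod (hg : Meromorphic g)
    (hnt : ∀ z, meromorphicOrderAt g z ≠ ⊤) (s : ℕ) :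
    iteratedDeriv s g / g =ᶠ[codiscrete ℂ]
      ∏ i ∈ Finset.range s, (logDeriv g + logDeriv (iteratedDeriv i g / g)) := by
  induction s with
  | zero =>
    filter_upwards [eventually_ne_zero hg hnt] with z hz
    simp [hz]
  | succ s ih =>
    rw [Finset.prod_range_succ]
    exact (iteratedDeriv_succ_div_eventuallyEq_mul hg hnt s).trans (ih.mul EventuallyEq.rfl)

lemma dominated_iteratedDeriv_div (hlog : log =o[atTop] T u) (hg : Meromorphic g)
    (hnt : ∀ z, meromorphicOrderAt g z ≠ ⊤) (hv : Dominated u (logDeriv g)) (s : ℕ) :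
    Dominated u (iteratedDeriv s g / g) := by
  induction s with
  | zero =>
    refine (dominated_const hlog 1).congr ((meromorphic_iteratedDeriv hg 0).div hg) ?_
    filter_upwards [eventually_ne_zero hg hnt] with z hz
    simp [hz]
  | succ s ih =>
    exact ((ih.deriv hlog).add hlog (hv.mul ih)).congr ((meromorphic_iteratedDeriv hg _).div hg)
      (iteratedDeriv_succ_div_eventuallyEq hg hnt s).symm

/-- After division by `g` the equation becomes the one of `norm_le_of_prod_add_sum_eq_zero` with `x
= g' / g`. The perturbations `w i` are logarithmic derivatives of functions dominated by `u`, so `g'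
/ g`, at first only dominated, is bounded pointwise by functions of small proximity. -/
theorem smallProximity_logDeriv_of_linOp_eq_zero {p : ℕ} {r : ℕ → RatFunc ℂ} (hp : 1 ≤ p)
    (hlog : log =o[atTop] T u) (hg : Meromorphic g) (hnt : ∀ z, meromorphicOrderAt g z ≠ ⊤)
    (hv : Dominated u (logDeriv g)) (h : linOp p r g =ᶠ[codiscrete ℂ] 0) :
    SmallProximity u (logDeriv g) := by
  set w : ℕ → ℂ → ℂ := fun i ↦ logDeriv (iteratedDeriv i g / g) with hw
  have hws : ∀ i, SmallProximity u (w i) := fun i ↦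
    (dominated_iteratedDeriv_div hlog hg hnt hv i).smallProximity_logDeriv hlog
  have hr : ∀ i, SmallProximity u (ratEval (r i)) := fun i ↦
    smallProximity_of_T_isLittleO (meromorphic_ratEval _) (T_ratEval_isLittleO hlog _)
  refine SmallProximity.of_norm_le hlog (ι := Option (Fin p ⊕ Fin p))
    (W := fun i ↦ i.elim (fun _ ↦ 1) (Sum.elim (fun i ↦ w i) (fun i ↦ ratEval (r i)))) ?_ hv.1 ?_
  · rintro (_ | i | i)
    · exact smallProximity_const hlog 1
    · exact hws i
    · exact hr i
  have hprod : ∀ᶠ z in codiscrete ℂ, ∀ s ∈ Finset.range (p + 1), iteratedDeriv s g z / g z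
      = ∏ i ∈ Finset.range s, (logDeriv g z + w i z) :=
    (Finset.eventually_all _).2 fun s _ ↦ by
      filter_upwards [iteratedDeriv_div_eventuallyEq_prod hg hnt s] with z hz
      simpa using hz
  filter_upwards [h, hprod, eventually_ne_zero hg hnt] with z hz hzp hz0
  have h1 := norm_le_of_prod_add_sum_eq_zero hp (logDeriv g z) (fun i ↦ w i z)
    (fun i ↦ ratEval (r i) z) (by
      rw [← hzp p (by simp), Finset.sum_congr rfl fun s hs ↦ by
        rw [← hzp s (by simp only [Finset.mem_range] at hs ⊢; lia)]]
      rw [linOp_apply] at hz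
      simp_rw [← mul_div_assoc]
      rw [← Finset.sum_div, ← add_div, hz, Pi.zero_apply, zero_div])
  simpa [Fintype.sum_option, Finset.sum_range] using h1

end LogDerivQuotients

lemma logDeriv_eventuallyEq_add {q : ℂ → ℂ} {f G : ℂ → ℂ} (hq : Meromorphic q)
    (hqnt : ∀ z, meromorphicOrderAt q z ≠ ⊤) (hG : Differentiable ℂ G)
    (hf : f =ᶠ[codiscrete ℂ] fun z ↦ q z * Complex.exp (G z)) :
    logDeriv f =ᶠ[codiscrete ℂ] logDeriv q + deriv G := by
  filter_upwards [hf, eventuallyEq_deriv hf, eventually_ne_zero hq hqnt, eventually_analyticAt hq]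
    with z h1 h2 h3 h4
  have hd : HasDerivAt (fun z ↦ q z * Complex.exp (G z))
      (deriv q z * Complex.exp (G z) + q z * (Complex.exp (G z) * deriv G z)) z :=
    h4.differentiableAt.hasDerivAt.mul (hG z).hasDerivAt.cexp
  simp only [logDeriv_apply, Pi.add_apply, h1, h2, hd.deriv]
  have := Complex.exp_ne_zero (G z)
  field_simp

/-- If `u = G'` were transcendental, it could itself serve as the yardstick. The logarithmic
derivative of `f^n` is `n (q' / q + u)`, dominated by `u`, hence of small proximity; so `m(r, u) =
S(r, u)`, whereas `m(r, u) = T(r, u)` for entire `u`. -/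
theorem deriv_exponent_not_transcendental {p n : ℕ} {r : ℕ → RatFunc ℂ} {f G : ℂ → ℂ}
    {q : RatFunc ℂ} (hp : 1 ≤ p) (hn : n ≠ 0) (hf : Meromorphic f)
    (hnt : ∀ z, meromorphicOrderAt f z ≠ ⊤)
    (hqnt : ∀ z, meromorphicOrderAt (ratEval q) z ≠ ⊤) (hG : Differentiable ℂ G)
    (hfG : f =ᶠ[codiscrete ℂ] fun z ↦ ratEval q z * Complex.exp (G z))
    (h : linOp p r (f ^ n) =ᶠ[codiscrete ℂ] 0) : ¬ TranscendentalMeromorphic (deriv G) := by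
  intro hu
  set u := deriv G with hu_def
  have hlog := hu.log_isLittleO_T
  have hud : Differentiable ℂ u := differentiableOn_univ.1 (hG.differentiableOn.deriv isOpen_univ)
  have hQ := meromorphic_ratEval q
  have hn0 : (n : ℂ) ≠ 0 := by exact_mod_cast hn
  have hv : logDeriv (f ^ n) =ᶠ[codiscrete ℂ] (fun _ ↦ (n : ℂ)) * (logDeriv (ratEval q) + u) := by
    filter_upwards [logDeriv_eventuallyEq_add hQ hqnt hG hfG, eventually_analyticAt hf] with z h1 h2
    have := logDeriv_fun_pow (f := f) h2.differentiableAt n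
    rw [Pi.mul_apply, ← h1]
    exact this
  have hQd : Dominated u (logDeriv (ratEval q)) :=
    ((dominated_ratEval hlog q).deriv hlog).mul ((dominated_ratEval hlog q).inv hlog)
  have hvd : Dominated u (logDeriv (f ^ n)) :=
    ((dominated_const hlog n).mul (hQd.add hlog ⟨hu.1, Asymptotics.isBigO_refl _ _⟩)).congr
      (meromorphic_pow hf n).logDeriv hv.symm
  have hvs := smallProximity_logDeriv_of_linOp_eq_zero hp hlog (meromorphic_pow hf n)
    (order_pow_ne_top hf hnt n) hvd h
  have hus : SmallProximity u u := by
    refine (((smallProximity_const hlog ((n : ℂ)⁻¹)).mul hvs).add hlog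
      ((smallProximity_const hlog (-1)).mul
        ((dominated_ratEval hlog q).smallProximity_logDeriv hlog))).congr hu.1 ?_
    filter_upwards [hv] with z hz
    simp only [Pi.add_apply, Pi.mul_apply, hz]
    field_simp
    ring
  have h1 := hus.2
  rw [← T_eq_proximity_of_differentiable hud] at h1
  refine Asymptotics.isLittleO_irrefl' (Eventually.frequently ?_) h1
  filter_upwards [((tendsto_T_atTop hlog).mono_left inf_le_left).eventually_gt_atTop 0] with r hr
  exact norm_ne_zero_iff.2 hr.ne'

theorem isRationalMulExp_of_linOp_pow_eq_zero {p n : ℕ} {r : ℕ → RatFunc ℂ} {f : ℂ → ℂ}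
    (hp : 1 ≤ p) (hpn : p ≤ n) (hf : TranscendentalMeromorphic f)
    (h : linOp p r (f ^ n) =ᶠ[codiscrete ℂ] 0) : IsRationalMulExp f := by
  have hn : n ≠ 0 := by lia
  have hfin := finite_divisor_support_of_linOp_pow_eq_zero hf.1 hf.order_ne_top hn hpn h
  obtain ⟨G, hG, hfG⟩ := exists_eq_prod_zpow_mul_exp hf.1 hf.order_ne_top hfin
  obtain ⟨q, hq0, hq⟩ := exists_ratEval_eq_prod_zpow hfin.toFinset
    (MeromorphicOn.divisor f Set.univ)
  have hfG' : f =ᶠ[codiscrete ℂ] fun z ↦ ratEval q z * Complex.exp (G z) := by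
    filter_upwards [hfG, hq] with z h1 h2
    rw [h1, h2]
  have hqnt : ∀ z, meromorphicOrderAt (ratEval q) z ≠ ⊤ := by
    refine (eventuallyEq_zero_or_forall_order_ne_top (meromorphic_ratEval q)).resolve_left
      fun h0 ↦ hf.2 ⟨0, ?_⟩
    filter_upwards [hfG', h0] with z h1 h2
    rw [h1, h2]
    simp [ratEval]
  have hud : Differentiable ℂ (deriv G) :=
    differentiableOn_univ.1 (hG.differentiableOn.deriv isOpen_univ)
  have hrat := deriv_exponent_not_transcendental hp hn hf.1 hf.order_ne_top hqnt hG hfG' h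
  obtain ⟨q', hq'⟩ : ∃ q' : RatFunc ℂ, deriv G =ᶠ[codiscrete ℂ] ratEval q' := by
    by_contra hne
    exact hrat ⟨fun z ↦ (hud.analyticAt z).meromorphicAt, hne⟩
  obtain ⟨a, ha⟩ := ratEval_eq_polynomial hud hq'
  obtain ⟨α, hα⟩ := exists_polynomial_of_deriv hG ha
  -- A constant exponent would make `f` rational.
  refine ⟨q, α, hq0, Nat.pos_of_ne_zero fun hd ↦ hf.2 ⟨q * RatFunc.C (Complex.exp (α.coeff 0)), ?_⟩,
    ?_⟩
  · filter_upwards [hfG', ratEval_mul_C q (Complex.exp (α.coeff 0))] with z h1 h2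
    rw [h1, h2, hα, Polynomial.eq_C_of_natDegree_eq_zero hd]
    simp
  · filter_upwards [hfG'] with z h1
    rw [h1, hα]

/-! ### Clunie's argument and the main estimate -/

/-- Where `‖y‖ ≤ 1` the left side is at most `‖φ‖`; where `‖y‖ ≥ 1` one divides the equation by
`y^γ`, and every power `d i ≤ γ` on the right is absorbed. -/
lemma norm_pow_mul_le {ι : Type} [Fintype ι] {n γ : ℕ} (hγ : γ ≤ n) {y φ R : ℂ} {d : ι → ℕ}
    {c : ι → ℂ} (hd : ∀ i, d i ≤ γ) (h : y ^ n * φ = R - ∑ i, y ^ d i * c i) :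
    ‖y ^ (n - γ) * φ‖ ≤ ‖φ‖ + (‖R‖ + ∑ i, ‖c i‖) := by
  have hS : 0 ≤ ∑ i, ‖c i‖ := Finset.sum_nonneg fun _ _ ↦ norm_nonneg _
  rcases le_total ‖y‖ 1 with hy | hy
  · rw [norm_mul, norm_pow]
    have h1 : ‖y‖ ^ (n - γ) * ‖φ‖ ≤ 1 * ‖φ‖ :=
      mul_le_mul_of_nonneg_right (pow_le_one₀ (norm_nonneg _) hy) (norm_nonneg _)
    have h2 := norm_nonneg R
    linarith
  · have hpos : 0 < ‖y‖ ^ γ := pow_pos (zero_lt_one.trans_le hy) _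
    have h1 : ‖y ^ (n - γ) * φ‖ * ‖y‖ ^ γ = ‖y ^ n * φ‖ := by
      rw [norm_mul, norm_mul, norm_pow, norm_pow, mul_right_comm, ← pow_add, Nat.sub_add_cancel hγ]
    have h2 : ‖y ^ n * φ‖ ≤ (‖R‖ + ∑ i, ‖c i‖) * ‖y‖ ^ γ := by
      rw [h, add_mul, Finset.sum_mul]
      refine (norm_sub_le _ _).trans (add_le_add
        (le_mul_of_one_le_right (norm_nonneg _) (one_le_pow₀ hy))
        ((norm_sum_le _ _).trans (Finset.sum_le_sum fun i _ ↦ ?_)))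
      rw [norm_mul, norm_pow, mul_comm]
      exact mul_le_mul_of_nonneg_left (pow_le_pow_right₀ hy (hd i)) (norm_nonneg _)
    have h3 := le_of_mul_le_mul_right (h1.trans_le h2) hpos
    linarith [norm_nonneg φ]

lemma IsSmall.isLittleO {φ f : ℂ → ℂ} (h : IsSmall φ f) : T φ =o[exceptional] T f := by
  obtain ⟨E, hE, h⟩ := h
  exact h.mono (exceptional_le_of_volume_lt_top hE)

namespace DiffPoly

/-- The `j`-th term of `P(z, f)`. -/
noncomputable def term (P : DiffPoly) (f : ℂ → ℂ) (j : Fin P.ℓ) : ℂ → ℂ :=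
  P.coeff j * ∏ s : Fin (P.k + 1), iteratedDeriv s f ^ P.exponent j s

/-- The `j`-th term of `P(z, f)` divided by the matching power of `f`. -/
noncomputable def quotientTerm (P : DiffPoly) (f : ℂ → ℂ) (j : Fin P.ℓ) : ℂ → ℂ :=
  P.coeff j * ∏ s : Fin (P.k + 1), (iteratedDeriv s f / f) ^ P.exponent j s

variable {P : DiffPoly} {f : ℂ → ℂ}

lemma sum_term (z : ℂ) : (∑ j, P.term f j) z = P.apply f z := by
  simp [apply, term, Finset.prod_apply]

lemma sum_exponent_le_degree (j : Fin P.ℓ) : ∑ s, P.exponent j s ≤ P.degree :=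
  Finset.le_sup (f := fun j ↦ ∑ s, P.exponent j s) (Finset.mem_univ j)

lemma term_eq {z : ℂ} (hz : f z ≠ 0) (j : Fin P.ℓ) :
    P.term f j z = f z ^ (∑ s, P.exponent j s) * P.quotientTerm f j z := by
  simp only [term, quotientTerm, Pi.mul_apply, Finset.prod_apply, Pi.pow_apply, Pi.div_apply]
  rw [mul_left_comm, ← Finset.prod_pow_eq_pow_sum, ← Finset.prod_mul_distrib]
  congr 1
  refine Finset.prod_congr rfl fun s _ ↦ ?_
  rw [← mul_pow, mul_div_cancel₀ _ hz]

lemma dominated_term (hlog : log =o[atTop] T f) (hf : Meromorphic f)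
    (hsmall : ∀ j, IsSmall (P.coeff j) f) (j : Fin P.ℓ) : Dominated f (P.term f j) := by
  have hff : Dominated f f := ⟨hf, Asymptotics.isBigO_refl _ _⟩
  exact Dominated.mul ⟨P.meromorphic_coeff j, (hsmall j).isLittleO.isBigO⟩
    (Dominated.prod hlog _ fun s ↦ (hff.iteratedDeriv hlog s).pow hlog _)

lemma smallProximity_quotientTerm (hlog : log =o[atTop] T f) (hf : Meromorphic f)
    (hsmall : ∀ j, IsSmall (P.coeff j) f) (j : Fin P.ℓ) : SmallProximity f (P.quotientTerm f j) := by
  have hff : Dominated f f := ⟨hf, Asymptotics.isBigO_refl _ _⟩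
  exact (smallProximity_of_T_isLittleO (P.meromorphic_coeff j) (hsmall j).isLittleO).mul
    (SmallProximity.prod hlog _ fun s ↦ (hff.smallProximity_iteratedDeriv_div hlog s).pow hlog _)

end DiffPoly

/-- This must also cover terms of `P(z, f)` that vanish identically: there the quotient is `0` by
convention, and `L 0 = 0`. -/
lemma linOp_eventuallyEq_mul_div {p : ℕ} {r : ℕ → RatFunc ℂ} {g : ℂ → ℂ} (hg : Meromorphic g) :
    linOp p r g =ᶠ[codiscrete ℂ] g * (linOp p r g / g) := by
  rcases eventuallyEq_zero_or_forall_order_ne_top hg with h0 | hnt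
  · filter_upwards [h0, linOp_congr (p := p) (r := r) h0] with z h1 h2
    simp [h1, h2, linOp_zero]
  · filter_upwards [eventually_ne_zero hg hnt] with z hz
    simp only [Pi.mul_apply, Pi.div_apply]
    field_simp

section MainEstimate

variable {n p : ℕ} {P : DiffPoly} {f h : ℂ → ℂ} {r : ℕ → RatFunc ℂ}

/-- This is `L` applied to the equation for `f`, term by term. Each term of `P(z, f)` is multiplied
by its own quotient `L(term) / term` and then written as a power of `f` times quotients `f^{(s)} /
f`. -/
lemma pow_mul_linOp_div_eventuallyEq (hf : TranscendentalMeromorphic f)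
    (hfh : SolvesTumuraClunie n P h f) (hode : SolvesLinearODE p r h) :
    ∀ᶠ z in codiscrete ℂ, f z ^ n * (linOp p r (f ^ n) / f ^ n) z = ratEval (r p) z
      - ∑ j, f z ^ (∑ s, P.exponent j s)
        * (P.quotientTerm f j * (linOp p r (P.term f j) / P.term f j)) z := by
  have hm : ∀ j, Meromorphic (P.term f j) := fun j ↦ (P.meromorphic_coeff j).mul
    (Meromorphic.prod fun s _ ↦ meromorphic_pow (meromorphic_iteratedDeriv hf.1 s) _)
  have h1 : f ^ n + ∑ j, P.term f j =ᶠ[codiscrete ℂ] h := by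
    filter_upwards [hfh] with z hz
    rw [← hz, Pi.add_apply, DiffPoly.sum_term, Pi.pow_apply]
  have h2 := linOp_congr (p := p) (r := r) h1
  have h3 := linOp_add (p := p) (r := r) (meromorphic_pow hf.1 n)
    (Meromorphic.sum (s := Finset.univ) fun j _ ↦ hm j)
  have h4 := linOp_sum (p := p) (r := r) Finset.univ hm
  have h5 : ∀ᶠ z in codiscrete ℂ, ∀ j,
      linOp p r (P.term f j) z = (P.term f j * (linOp p r (P.term f j) / P.term f j)) z :=
    eventually_all.2 fun j ↦ linOp_eventuallyEq_mul_div (hm j)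
  filter_upwards [h2, h3, h4, h5, hode, linOp_eventuallyEq_mul_div (p := p) (r := r)
    (meromorphic_pow hf.1 n), eventually_ne_zero hf.1 hf.order_ne_top] with z h2 h3 h4 h5 hode h6 h7
  rw [← linOp_apply] at hode
  rw [h3, Pi.add_apply, h4, Finset.sum_apply, hode, h6, Finset.sum_congr rfl fun j _ ↦ h5 j] at h2
  rw [← h2]
  simp only [Pi.mul_apply, DiffPoly.term_eq h7]
  simp [mul_assoc]

theorem proximity_estimate (hp : 1 ≤ p) (hpn : p ≤ n) (hPn : P.degree ≤ n)
    (hf : TranscendentalMeromorphic f) (hsmall : ∀ j, IsSmall (P.coeff j) f)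
    (hfh : SolvesTumuraClunie n P h f) (hode : SolvesLinearODE p r h)
    (hnot : ¬ IsRationalMulExp f) : ∃ ε : ℝ → ℝ, ε =o[exceptional] T f ∧ ∀ᶠ R in exceptional,
      ((n : ℝ) - P.degree) * proximity f ⊤ R
        ≤ p * (reducedLogCounting f 0 R + reducedLogCounting f ⊤ R) + ε R := by
  have hlog := hf.log_isLittleO_T
  have hn : n ≠ 0 := by lia
  have hff : Dominated f f := ⟨hf.1, Asymptotics.isBigO_refl _ _⟩
  set φ : ℂ → ℂ := linOp p r (f ^ n) / f ^ n with hφ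
  have hφs : SmallProximity f φ := smallProximity_linOp_div hlog (hff.pow hlog n)
  -- If `φ` vanished identically, so would `L(f^n)`, and `f` would have the excluded form. This is
  -- needed to divide by `φ`.
  have hφnt : ∀ z, meromorphicOrderAt φ z ≠ ⊤ := by
    refine (eventuallyEq_zero_or_forall_order_ne_top hφs.1).resolve_left fun h0 ↦
      hnot (isRationalMulExp_of_linOp_pow_eq_zero hp hpn hf (r := r) ?_)
    filter_upwards [h0, linOp_eventuallyEq_mul_div (p := p) (r := r) (meromorphic_pow hf.1 n)]
      with z h1 h2
    rw [h2, Pi.mul_apply, ← hφ, h1]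
    simp
  have hr : ∀ i, SmallProximity f (ratEval (r i)) := fun i ↦
    smallProximity_of_T_isLittleO (meromorphic_ratEval _) (T_ratEval_isLittleO hlog _)
  set c : Fin P.ℓ → ℂ → ℂ := fun j ↦
    P.quotientTerm f j * (linOp p r (P.term f j) / P.term f j) with hc
  have hcs : ∀ j, SmallProximity f (c j) := fun j ↦
    (P.smallProximity_quotientTerm hlog hf.1 hsmall j).mul
      (smallProximity_linOp_div hlog (P.dominated_term hlog hf.1 hsmall j))
  have hΨ : SmallProximity f (f ^ (n - P.degree) * φ) := by
    refine SmallProximity.of_norm_le hlog (ι := Option (Option (Fin P.ℓ)))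
      (W := fun i ↦ i.elim φ fun i ↦ i.elim (ratEval (r p)) c) ?_
      ((meromorphic_pow hf.1 _).mul hφs.1) ?_
    · rintro (_ | _ | j)
      exacts [hφs, hr p, hcs j]
    · filter_upwards [pow_mul_linOp_div_eventuallyEq hf hfh hode] with z hz
      rw [Fintype.sum_option, Fintype.sum_option]
      exact norm_pow_mul_le hPn P.sum_exponent_le_degree hz
  refine ⟨fun R ↦ proximity (f ^ (n - P.degree) * φ) ⊤ R + (proximity φ ⊤ R
    + (∑ s ∈ Finset.range p, T (ratEval (r s)) R + |log ‖meromorphicTrailingCoeffAt φ 0‖|)), ?_, ?_⟩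
  · exact hΨ.2.add (hφs.2.add ((Asymptotics.IsLittleO.fun_sum fun s _ ↦
      T_ratEval_isLittleO hlog (r s)).add (isLittleO_const_T hlog _)))
  · filter_upwards [eventually_exceptional_ge 1] with R hR
    -- Hence `(n - γ) m(f) ≤ m(f^{n-γ} φ) + m(1/φ)`, and by the first main theorem `m(1/φ) ≤ m(φ) +
    -- N(φ) + O(1)`. Only `N(φ)` is not small.
    have heq : f ^ (n - P.degree) =ᶠ[codiscrete ℂ] (f ^ (n - P.degree) * φ) * φ⁻¹ := by
      filter_upwards [eventually_ne_zero hφs.1 hφnt] with z hz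
      simp [hz]
    have h1 := proximity_mul_top_le hΨ.1 hφs.1.inv R
    rw [← proximity_congr_codiscrete heq (by linarith), proximity_pow_top] at h1
    have h2 := T_inv hφs.1 (by linarith : R ≠ 0)
    have h3 := logCounting_linOp_div_pow_le (p := p) (r := r) hf.1 hf.order_ne_top hn hR
    have h4 : ∑ s ∈ Finset.range p, logCounting (ratEval (r s)) ⊤ R
        ≤ ∑ s ∈ Finset.range p, T (ratEval (r s)) R := Finset.sum_le_sum fun s _ ↦
      le_add_of_nonneg_left (proximity_nonneg R)
    have h5 := logCounting_nonneg (f := φ⁻¹) (e := ⊤) hR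
    have h6 := neg_abs_le (log ‖meromorphicTrailingCoeffAt φ 0‖)
    rw [← hφ] at h3
    simp only [T, characteristic, Pi.add_apply, Pi.smul_apply, nsmul_eq_mul,
      Nat.cast_sub hPn] at h1 h2 h4 ⊢
    linarith

end MainEstimate

/-! ### From the estimate to deficiencies -/

lemma isBoundedUnder_logCounting_div {f : ℂ → ℂ} {u : ℝ → ℝ} {κ : ℝ} (hlog : log =o[atTop] T f)
    (h : ∀ᶠ r in atTop, u r ≤ T f r + κ) :
    IsBoundedUnder (· ≤ ·) atTop fun r ↦ u r / T f r := by
  refine isBoundedUnder_of_eventually_le (a := 1 + |κ|) ?_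
  filter_upwards [h, (tendsto_T_atTop hlog).eventually_ge_atTop 1] with r hr h1
  rw [div_le_iff₀ (by linarith), add_mul, one_mul]
  have := le_mul_of_one_le_right (abs_nonneg κ) h1
  linarith [le_abs_self κ]

theorem deficiency_sum_le {f : ℂ → ℂ} (hf : Meromorphic f) (hlog : log =o[atTop] T f) {a p : ℝ}
    (ha : 0 ≤ a) (hp : 0 < p) {ε : ℝ → ℝ} (hε : ε =o[exceptional] T f)
    (h : ∀ᶠ R in exceptional, a * proximity f ⊤ R
      ≤ p * (reducedLogCounting f 0 R + reducedLogCounting f ⊤ R) + ε R) :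
    ramifiedDeficiency 0 f + ramifiedDeficiency ⊤ f + a / p * deficiency ⊤ f ≤ 2 := by
  -- The real-valued `limsup` of an unbounded quotient would be a default value, so upper bounds on
  -- `limsup` give eventual bounds only after boundedness is checked.
  have b0 : IsBoundedUnder (· ≤ ·) atTop fun r ↦ reducedLogCounting f 0 r / T f r := by
    refine isBoundedUnder_logCounting_div (κ := -log ‖meromorphicTrailingCoeffAt f 0‖) hlog ?_
    filter_upwards [eventually_ge_atTop 1] with r hr
    have h1 := reducedLogCounting_zero_le (f := f) hr
    have h2 := T_inv hf (by linarith : r ≠ 0)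
    have h3 := proximity_nonneg (f := f⁻¹) (a := ⊤) r
    rw [← logCounting_inv] at h1
    simp only [T, characteristic, Pi.add_apply, Pi.zero_apply] at h2 h3 ⊢
    linarith
  have bN : IsBoundedUnder (· ≤ ·) atTop fun r ↦ logCounting f ⊤ r / T f r :=
    isBoundedUnder_logCounting_div (κ := 0) hlog (Eventually.of_forall fun r ↦ by
      rw [add_zero]
      exact le_add_of_nonneg_left (proximity_nonneg r))
  have bR : IsBoundedUnder (· ≤ ·) atTop fun r ↦ reducedLogCounting f ⊤ r / T f r := by
    refine isBoundedUnder_logCounting_div (κ := 0) hlog ?_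
    filter_upwards [eventually_ge_atTop 1] with r hr
    rw [add_zero]
    exact (reducedLogCounting_top_le hr).trans (le_add_of_nonneg_left (proximity_nonneg r))
  simp only [ramifiedDeficiency, deficiency]
  set A := limsup (fun r ↦ reducedLogCounting f 0 r / T f r) atTop
  set B := limsup (fun r ↦ reducedLogCounting f ⊤ r / T f r) atTop
  set C := limsup (fun r ↦ logCounting f ⊤ r / T f r) atTop
  -- The bounds coming from `limsup` hold for all large `R`, the estimate only off an exceptional
  -- set. One common `R` suffices, since after division by `T f R` the inequality no longer involves
  -- `R`.
  have key : ∀ η > 0, a * (1 - C - η) ≤ p * (A + B + 2 * η) + η := by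
    intro η hη
    have e1 := (eventually_lt_of_limsup_lt (lt_add_of_pos_right A hη) b0).filter_mono
      (inf_le_left : exceptional ≤ atTop)
    have e2 := (eventually_lt_of_limsup_lt (lt_add_of_pos_right B hη) bR).filter_mono
      (inf_le_left : exceptional ≤ atTop)
    have e3 := (eventually_lt_of_limsup_lt (lt_add_of_pos_right C hη) bN).filter_mono
      (inf_le_left : exceptional ≤ atTop)
    have e4 := ((tendsto_T_atTop hlog).eventually_gt_atTop 0).filter_mono
      (inf_le_left : exceptional ≤ atTop)
    obtain ⟨R, h1, h2, h3, h4, h5, h6⟩ :=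
      (e1.and (e2.and (e3.and (e4.and (h.and (hε.bound hη)))))).exists
    rw [div_lt_iff₀ h4] at h1 h2 h3
    rw [Real.norm_of_nonneg h4.le] at h6
    have h7 := (le_abs_self (ε R)).trans h6
    have hT : T f R = proximity f ⊤ R + logCounting f ⊤ R := rfl
    have h8 : a * ((1 - C - η) * T f R) ≤ a * proximity f ⊤ R :=
      mul_le_mul_of_nonneg_left (by linarith) ha
    have h9 : p * (reducedLogCounting f 0 R + reducedLogCounting f ⊤ R)
        ≤ p * ((A + B + 2 * η) * T f R) := mul_le_mul_of_nonneg_left (by linarith) hp.le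
    refine le_of_mul_le_mul_right ?_ h4
    linarith
  have hlim : a * (1 - C) ≤ p * (A + B) := by
    have t1 : Tendsto (fun η : ℝ ↦ a * (1 - C - η)) (𝓝[>] 0) (𝓝 (a * (1 - C))) := by
      have : Continuous fun η : ℝ ↦ a * (1 - C - η) := by fun_prop
      simpa using (this.tendsto 0).mono_left nhdsWithin_le_nhds
    have t2 : Tendsto (fun η : ℝ ↦ p * (A + B + 2 * η) + η) (𝓝[>] 0) (𝓝 (p * (A + B))) := by
      have : Continuous fun η : ℝ ↦ p * (A + B + 2 * η) + η := by fun_prop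
      simpa using (this.tendsto 0).mono_left nhdsWithin_le_nhds
    exact le_of_tendsto_of_tendsto t1 t2 (eventually_mem_nhdsWithin.mono key)
  have hdiv : a / p * (1 - C) ≤ A + B := by
    rw [div_mul_eq_mul_div, div_le_iff₀ hp]
    linarith
  linarith

end TumuraClunie

theorem corollary1 (n p : ℕ) (hn : 2 ≤ n) (hp : 1 ≤ p) (hpn : p ≤ n)
    (P : TumuraClunie.DiffPoly) (hP1 : 1 ≤ P.degree) (hPn : P.degree ≤ n - 1)
    (f h : ℂ → ℂ) (hf : TumuraClunie.TranscendentalMeromorphic f)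
    (hsmall : ∀ j, TumuraClunie.IsSmall (P.coeff j) f)
    (hfh : TumuraClunie.SolvesTumuraClunie n P h f)
    (hh : Meromorphic h)
    (r : ℕ → RatFunc ℂ) (hr0 : r 0 ≠ 0) (hode : TumuraClunie.SolvesLinearODE p r h)
    (hnot : ¬ TumuraClunie.IsRationalMulExp f) :
    TumuraClunie.ramifiedDeficiency 0 f + TumuraClunie.ramifiedDeficiency ⊤ f
      + ((n : ℝ) - (P.degree : ℝ)) / (p : ℝ) * TumuraClunie.deficiency ⊤ f ≤ 2 := by
  have hPn' : P.degree ≤ n := by lia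
  obtain ⟨ε, hε, h⟩ := TumuraClunie.proximity_estimate hp hpn hPn' hf hsmall hfh hode hnot
  exact TumuraClunie.deficiency_sum_le hf.1 hf.log_isLittleO_T
    (sub_nonneg.2 (by exact_mod_cast hPn')) (by exact_mod_cast hp) hε h
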